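/- Let $d\ge 1$ be an integer, and let $p\ge 1$ and $r\in(1,2)$ be real numbers. Let $X_1,\dots,X_n$ ($n\ge 1$) be independent random vectors in $\mathbb R^d$ with common distribution $\mu$, and let $\mu_k=\frac1k\sum_{i=1}^k\delta_{X_i}$ for $1\le k\le n$. For probability measures $\nu_1,\nu_2$ on $\mathbb R^d$ let $$W_p^p(\nu_1,\nu_2)=\inf_{\pi}\int_{\mathbb R^d\times\mathbb R^d}|x-y|_2^p\,\pi(dx,dy),$$ where the infimum is over all probability measures $\pi$ on $\mathbb R^d\times\mathbb R^d$ with marginals $\nu_1,\nu_2$, and $|\cdot|_2$ is the Euclidean norm. Let $\|X\|_{q}^{q}=\int_{\mathbb R^d}\max_{1\le i\le d}|x_i|^{q}\,\mu(dx)$, and for a random variable $Y\ge 0$ let $\|Y\|_r^r=\mathbb E(Y^r)$. Suppose that $\|X\|_{rp}<\infty$. Then $W_p^p(\mu_n,\mu)$ and $\max_{1\le k\le n}kW_p^p(\mu_k,\mu)$ are random variables (that is, measurable), and there is a constant $C>0$, depending only on $p$, $d$ and $r$ (not on $n$, on $\mu$ or on the probability space), such that - if $p>d(r-1)/r$, then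 $$\big\|W_p^p(\mu_n,\mu)\big\|_r^r\le C\,\frac{\|X\|_{rp}^{rp}}{n^{r-1}}\qquad\text{and}\qquad \frac1{n^r}\Big\|\max_{1\le k\le n}k\,W_p^p(\mu_k,\mu)\Big\|_r^r\le C\,\frac{\|X\|_{rp}^{rp}}{n^{r-1}};$$ - if $p<d(r-1)/r$, then $$\big\|W_p^p(\mu_n,\mu)\big\|_r^r\le C\,\frac{\|X\|_{rp}^{rp}}{n^{rp/d}}\qquad\text{and}\qquad \frac1{n^r}\Big\|\max_{1\le k\le n}k\,W_p^p(\mu_k,\mu)\Big\|_r^r\le C\,\frac{\|X\|_{rp}^{rp}}{n^{rp/d}}.$$ -/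

import Mathlib

open MeasureTheory ProbabilityTheory
open scoped NNReal ENNReal

noncomputable section

/-- The set `Π(ν₁, ν₂)` of couplings: probability measures on the product with marginals `ν₁`, `ν₂`. -/
def measureCouplings {E : Type*} [MeasurableSpace E] (ν₁ ν₂ : Measure E) : Set (Measure (E × E)) :=
  {π | IsProbabilityMeasure π ∧ π.map Prod.fst = ν₁ ∧ π.map Prod.snd = ν₂}

/-- The quantity `W_p^p(ν₁, ν₂)`, with values in `[0, ∞]`, for the Euclidean distance on `ℝ^d`. -/
def wassersteinPow {d : ℕ} (p : ℝ) (ν₁ ν₂ : Measure (EuclideanSpace ℝ (Fin d))) : ℝ≥0∞ :=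
  ⨅ π ∈ measureCouplings ν₁ ν₂, ∫⁻ z, edist z.1 z.2 ^ p ∂π

/-- The moment `‖X‖_q^q = E(|X|^q)` of a variable with law `μ`, where `|x| = max_i |x_i|`
(the norm of the underlying function `Fin d → ℝ` is the maximum norm). -/
def supNormMoment {d : ℕ} (q : ℝ) (μ : Measure (EuclideanSpace ℝ (Fin d))) : ℝ≥0∞ :=
  ∫⁻ x, ‖WithLp.ofLp x‖ₑ ^ q ∂μ

/-- The empirical measure `(1/n) ∑ δ_{x_i}` of `n` points. -/
def empiricalMeasure {d n : ℕ} (x : Fin n → EuclideanSpace ℝ (Fin d)) :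
    Measure (EuclideanSpace ℝ (Fin d)) :=
  (n : ℝ≥0∞)⁻¹ • ∑ i, Measure.dirac (x i)

/-- `max_{1 ≤ k ≤ n} k W_p^p(μ_k, μ)`, where `μ_k` is the empirical measure of the first `k` among
the `n` points `x`; here `k` is written `j + 1` with `j : Fin n`. -/
def maxWassersteinPow {d n : ℕ} (p : ℝ) (x : Fin n → EuclideanSpace ℝ (Fin d))
    (μ : Measure (EuclideanSpace ℝ (Fin d))) : ℝ≥0∞ :=
  ⨆ j : Fin n, ((j.val + 1 : ℕ) : ℝ≥0∞) *
    wassersteinPow p (empiricalMeasure fun i : Fin (j.val + 1) => x (Fin.castLE j.isLt i)) μ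

/-- `X_1, …, X_n` are independent random vectors with common law `μ`. -/
structure IsIIDSample {Ω : Type*} [MeasurableSpace Ω] {d n : ℕ} (P : Measure Ω)
    (μ : Measure (EuclideanSpace ℝ (Fin d))) (X : Fin n → Ω → EuclideanSpace ℝ (Fin d)) :
    Prop where
  measurable : ∀ i, Measurable (X i)
  indep : iIndepFun X P
  law : ∀ i, P.map (X i) = μ

end

/-! The maximum dominates its `k = n` term, so only its moments need a bound, and since the
quantities are measurable functions of the sample, the expectations can be computed under the
product measure `Measure.pi fun _ => μ`.

Transport cost is controlled by a multiscale matching. Space is cut into the shells `R * 2 ^ (m - 1)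
< |x| ≤ R * 2 ^ m`, with a ball for `m = 0`, and at level `l` each shell is cut into dyadic cubes of
side `R * 2 ^ m / 2 ^ l`. Matching mass inside the finest cells first and moving the remainder up
the tree bounds the cost by a weighted sum, over all levels and cells, of the differences of the two
masses (`wassersteinPow_le_tsum_cells`). Multiplied by `k` and maximised over `k ≤ n`, this sum
becomes a functional `F` of partial sums of centred indicators, `maxDeviation`.

The moment of order `r` of `F` splits into a fluctuation and a mean. Replacing one sample point `x
i` by `y` changes `F` by at most `g (x i) + g y`, where `g` adds the weights of the cells containing
a point and is of order `(R * 2 ^ m) ^ p` on the shell `m`. A von Bahr–Esseen argument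
(`integral_abs_sub_integral_rpow_le`) then gives a fluctuation of order `n * R ^ (r * p)`. For the
mean, Kolmogorov's maximal inequality bounds the contribution of a cell `A` by its weight times `2 *
min (n * μ A) √(n * μ A)`.

The bound `min a √a ≤ a ^ (1 - u)`, valid for every `u` in `[0, 1/2]`, together with the number of
cubes and Markov's inequality on the shells, bounds the sum over one level and shell by a multiple
of `R ^ p * n ^ (1 - u) * 2 ^ (p * r * m * (u - (r - 1) / r)) * 2 ^ (d * l * (u - p / d))`. Let `v`
be the smaller of `(r - 1) / r` and `p / d`. Choosing `u` slightly above or below `v`, term by term,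
makes the double series converge with sum of order `n ^ (1 - v)` (`exists_tsum_tsum_le`); the
critical case, where the exponents coincide, would lose a logarithm in this argument. Dividing the
moment by `n ^ r` leaves `n ^ (1 - r) + n ^ (-r * v)`, in which the second term dominates. Finally
`R ^ (r * p)` decreases to the moment of `μ`. -/

open Filter Topology

/-! ### Measurability of the transport cost of an empirical measure -/

section Empirical

variable {d n : ℕ}

lemma lintegral_empiricalMeasure (x : Fin n → EuclideanSpace ℝ (Fin d))
    {f : EuclideanSpace ℝ (Fin d) → ℝ≥0∞} :
    ∫⁻ y, f y ∂(empiricalMeasure x) = (n : ℝ≥0∞)⁻¹ * ∑ i, f (x i) := by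
  simp [empiricalMeasure, lintegral_smul_measure, lintegral_finsetSum_measure, lintegral_dirac]

lemma isProbabilityMeasure_empiricalMeasure (hn : 1 ≤ n) (x : Fin n → EuclideanSpace ℝ (Fin d)) :
    IsProbabilityMeasure (empiricalMeasure x) := by
  constructor
  rw [← lintegral_one, lintegral_empiricalMeasure]
  simp only [Finset.sum_const, Finset.card_univ, Fintype.card_fin, nsmul_eq_mul, mul_one]
  exact ENNReal.inv_mul_cancel (by simpa using (by omega : n ≠ 0)) (by simp)

/-- The families of probability measures whose average is `μ`: these are the disintegrations of the
couplings of an empirical measure of `n` points with `μ`. -/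
def averagingFamilies (n : ℕ) {E : Type*} [MeasurableSpace E] (μ : Measure E) :
    Set (Fin n → Measure E) :=
  {κ | (∀ i, IsProbabilityMeasure (κ i)) ∧ (n : ℝ≥0∞)⁻¹ • ∑ i, κ i = μ}

/-- Disintegrating a coupling along its first marginal needs only the kernel at the sample points,
which may repeat. The point of this form is that the index set of the infimum no longer depends on
`x`. -/
lemma wassersteinPow_empiricalMeasure (hn : 1 ≤ n) (p : ℝ)
    (x : Fin n → EuclideanSpace ℝ (Fin d)) (μ : Measure (EuclideanSpace ℝ (Fin d))) :
    wassersteinPow p (empiricalMeasure x) μ = ⨅ κ ∈ averagingFamilies n μ,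
      (n : ℝ≥0∞)⁻¹ * ∑ i, ∫⁻ y, edist (x i) y ^ p ∂(κ i) := by
  have hn0 : (n : ℝ≥0∞) ≠ 0 := by simpa using (by omega : n ≠ 0)
  apply le_antisymm
  · refine le_iInf₂ fun κ hκ => ?_
    have := hκ.1
    have hmass : (n : ℝ≥0∞)⁻¹ * n = 1 := ENNReal.inv_mul_cancel hn0 (by simp)
    have hc : (n : ℝ≥0∞)⁻¹ • ∑ i, (Measure.dirac (x i)).prod (κ i)
        ∈ measureCouplings (empiricalMeasure x) μ := by
      refine ⟨⟨?_⟩, ?_, ?_⟩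
      · simp [hmass]
      · ext s hs
        rw [Measure.map_apply measurable_fst hs]
        simp [empiricalMeasure, ← Set.prod_univ, Measure.prod_prod]
      · rw [← hκ.2]
        ext s hs
        rw [Measure.map_apply measurable_snd hs]
        simp [← Set.univ_prod, Measure.prod_prod]
    refine (iInf₂_le _ hc).trans ?_
    rw [lintegral_smul_measure, lintegral_finsetSum_measure, smul_eq_mul]
    gcongr with i
    rw [lintegral_prod _ (by fun_prop), lintegral_dirac]
  · refine le_iInf₂ fun π hπ => ?_
    have := hπ.1
    have hfst : π.fst = empiricalMeasure x := hπ.2.1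
    have hsnd : π.snd = μ := hπ.2.2
    have key : ∀ f : EuclideanSpace ℝ (Fin d) × EuclideanSpace ℝ (Fin d) → ℝ≥0∞, Measurable f →
        ∫⁻ z, f z ∂π = (n : ℝ≥0∞)⁻¹ * ∑ i, ∫⁻ y, f (x i, y) ∂(π.condKernel (x i)) := by
      intro f hf
      conv_lhs => rw [← π.disintegrate π.condKernel]
      rw [Measure.lintegral_compProd hf, hfst, lintegral_empiricalMeasure]
    have hc : (fun i => π.condKernel (x i)) ∈ averagingFamilies n μ := by
      refine ⟨fun i => inferInstance, ?_⟩
      ext s hs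
      have h1 := key (s.indicator 1 ∘ Prod.snd)
        ((measurable_one.indicator hs).comp measurable_snd)
      rw [← hsnd, Measure.snd, Measure.map_apply measurable_snd hs]
      have h2 : (s.indicator 1 ∘ Prod.snd :
          EuclideanSpace ℝ (Fin d) × EuclideanSpace ℝ (Fin d) → ℝ≥0∞)
          = (Prod.snd ⁻¹' s).indicator 1 := rfl
      rw [h2, lintegral_indicator_one (measurable_snd hs)] at h1
      rw [h1]
      have h3 : ∀ i, ∫⁻ y, (Prod.snd ⁻¹' s).indicator 1 (x i, y) ∂(π.condKernel (x i))
          = π.condKernel (x i) s := fun i => lintegral_indicator_one hs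
      simp [h3]
    refine (iInf₂_le _ hc).trans ?_
    rw [key _ (by fun_prop)]

lemma edist_le_mul_edist_ofLp (x y : EuclideanSpace ℝ (Fin d)) :
    edist x y ≤ ((d : ℝ≥0) : ℝ≥0∞) * edist (WithLp.ofLp x) (WithLp.ofLp y) := by
  rcases Nat.eq_zero_or_pos d with rfl | hd
  · have : x = y := Subsingleton.elim _ _
    simp [this]
  refine (PiLp.antilipschitzWith_ofLp 2 (fun _ : Fin d => ℝ) x y).trans ?_
  gcongr
  simp only [Fintype.card_fin]
  conv_rhs => rw [← NNReal.rpow_one (d : ℝ≥0)]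
  exact NNReal.rpow_le_rpow_of_exponent_le (by exact_mod_cast hd) (by norm_num)

lemma lintegral_ofLp_rpow_lt_top {p r : ℝ} (hp : 1 ≤ p) (hr : 1 < r)
    {μ : Measure (EuclideanSpace ℝ (Fin d))} [IsProbabilityMeasure μ]
    (hμ : supNormMoment (r * p) μ < ∞) : ∫⁻ x, ‖WithLp.ofLp x‖ₑ ^ p ∂μ < ∞ := by
  have hb : ∀ x : EuclideanSpace ℝ (Fin d), ‖WithLp.ofLp x‖ₑ ^ p
      ≤ 1 + ‖WithLp.ofLp x‖ₑ ^ (r * p) := by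
    intro x
    rcases le_total ‖WithLp.ofLp x‖ₑ 1 with h | h
    · exact (ENNReal.rpow_le_one h (by linarith)).trans le_self_add
    · exact (ENNReal.rpow_le_rpow_of_exponent_le h (by nlinarith)).trans le_add_self
  refine (lintegral_mono hb).trans_lt ?_
  rw [lintegral_add_left measurable_const]
  simpa [supNormMoment] using hμ

lemma lintegral_edist_rpow_lt_top {p : ℝ} (hp : 1 ≤ p)
    {μ : Measure (EuclideanSpace ℝ (Fin d))} [IsProbabilityMeasure μ]
    (hμ : ∫⁻ x, ‖WithLp.ofLp x‖ₑ ^ p ∂μ < ∞) (R : ℝ≥0∞) (hR : R ≠ ∞) :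
    ∫⁻ y, (R + edist 0 y) ^ p ∂μ < ∞ := by
  have hb : ∀ y : EuclideanSpace ℝ (Fin d), (R + edist 0 y) ^ p
      ≤ 2 ^ (p - 1) * (R ^ p + ((d : ℝ≥0) : ℝ≥0∞) ^ p * ‖WithLp.ofLp y‖ₑ ^ p) := by
    intro y
    refine (ENNReal.rpow_add_le_mul_rpow_add_rpow _ _ hp).trans ?_
    gcongr
    rw [← ENNReal.mul_rpow_of_nonneg _ _ (by linarith)]
    gcongr
    have := edist_le_mul_edist_ofLp 0 y
    rwa [WithLp.ofLp_zero, edist_zero_left (WithLp.ofLp y)] at this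
  refine (lintegral_mono hb).trans_lt ?_
  rw [lintegral_const_mul' _ _ (ENNReal.rpow_ne_top_of_nonneg (by linarith) (by simp)),
    lintegral_add_left measurable_const,
    lintegral_const_mul' _ _ (ENNReal.rpow_ne_top_of_nonneg (by linarith) (by simp))]
  refine ENNReal.mul_lt_top (ENNReal.rpow_lt_top_of_nonneg (by linarith) (by simp)) ?_
  refine ENNReal.add_lt_top.2 ⟨?_, ENNReal.mul_lt_top
    (ENNReal.rpow_lt_top_of_nonneg (by linarith) (by simp)) hμ⟩
  simpa using (ENNReal.rpow_lt_top_of_nonneg (by linarith) hR)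

lemma continuous_lintegral_edist_rpow {p : ℝ} (hp : 1 ≤ p)
    {μ : Measure (EuclideanSpace ℝ (Fin d))} [IsProbabilityMeasure μ]
    (hμ : ∫⁻ x, ‖WithLp.ofLp x‖ₑ ^ p ∂μ < ∞) :
    Continuous fun x : EuclideanSpace ℝ (Fin d) => ∫⁻ y, edist x y ^ p ∂μ := by
  rw [continuous_iff_continuousAt]
  intro x
  refine tendsto_lintegral_filter_of_dominated_convergence
    (fun y => (1 + edist x 0 + edist 0 y) ^ p) (Eventually.of_forall fun _ => by fun_prop) ?_
    (lintegral_edist_rpow_lt_top hp hμ _ (by simp)).ne ?_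
  · filter_upwards [Metric.eball_mem_nhds x one_pos] with z hz
    refine Eventually.of_forall fun y => ENNReal.rpow_le_rpow ?_ (by linarith)
    calc edist z y ≤ edist z x + edist x y := edist_triangle _ _ _
      _ ≤ 1 + (edist x 0 + edist 0 y) := add_le_add (le_of_lt hz) (edist_triangle _ _ _)
      _ = _ := (add_assoc _ _ _).symm
  · refine Eventually.of_forall fun y => ?_
    exact ((ENNReal.continuous_rpow_const).tendsto _).comp
      ((continuous_id.edist continuous_const).tendsto x)

/-- An infimum of continuous functions, even an uncountable one, is upper semicontinuous. This gives
measurability without selecting optimal couplings. -/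
lemma upperSemicontinuous_wassersteinPow_empiricalMeasure {p : ℝ} (hp : 1 ≤ p) (hn : 1 ≤ n)
    {μ : Measure (EuclideanSpace ℝ (Fin d))} [IsProbabilityMeasure μ]
    (hμ : ∫⁻ x, ‖WithLp.ofLp x‖ₑ ^ p ∂μ < ∞) :
    UpperSemicontinuous fun x : Fin n → EuclideanSpace ℝ (Fin d) =>
      wassersteinPow p (empiricalMeasure x) μ := by
  simp_rw [wassersteinPow_empiricalMeasure hn]
  refine upperSemicontinuous_iInf fun κ => upperSemicontinuous_iInf fun hκ => ?_
  refine Continuous.upperSemicontinuous ?_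
  refine (ENNReal.continuous_const_mul (by simpa using (by omega : n ≠ 0))).comp ?_
  refine continuous_finsetSum _ fun i _ => ?_
  have := hκ.1 i
  refine (continuous_lintegral_edist_rpow hp ?_).comp (continuous_apply i)
  have hn0 : (n : ℝ≥0∞)⁻¹ ≠ 0 := by simp
  -- Each member of the family inherits a finite moment of order `p` from the average `μ`.
  by_contra htop
  rw [not_lt, top_le_iff] at htop
  rw [← hκ.2, lintegral_smul_measure, lintegral_finsetSum_measure] at hμ
  refine hμ.ne (ENNReal.mul_eq_top.2 (Or.inl ⟨hn0, ?_⟩))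
  exact ENNReal.sum_eq_top.2 ⟨i, Finset.mem_univ i, htop⟩

lemma measurable_wassersteinPow_empiricalMeasure {p : ℝ} (hp : 1 ≤ p) (hn : 1 ≤ n)
    {μ : Measure (EuclideanSpace ℝ (Fin d))} [IsProbabilityMeasure μ]
    (hμ : ∫⁻ x, ‖WithLp.ofLp x‖ₑ ^ p ∂μ < ∞) :
    Measurable fun x : Fin n → EuclideanSpace ℝ (Fin d) =>
      wassersteinPow p (empiricalMeasure x) μ :=
  (upperSemicontinuous_wassersteinPow_empiricalMeasure hp hn hμ).measurable

lemma measurable_maxWassersteinPow {p : ℝ} (hp : 1 ≤ p)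
    {μ : Measure (EuclideanSpace ℝ (Fin d))} [IsProbabilityMeasure μ]
    (hμ : ∫⁻ x, ‖WithLp.ofLp x‖ₑ ^ p ∂μ < ∞) :
    Measurable fun x : Fin n → EuclideanSpace ℝ (Fin d) => maxWassersteinPow p x μ := by
  refine Measurable.iSup fun j => Measurable.const_mul ?_ _
  exact (measurable_wassersteinPow_empiricalMeasure hp (Nat.le_add_left 1 _) hμ).comp
    (measurable_pi_lambda _ fun i => measurable_pi_apply _)

end Empirical

/-! ### Multiscale couplings along nested partitions -/

section TreeCoupling

variable {E ι : Type*} [MeasurableSpace E] [MeasurableSpace ι] [Countable ι]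
  [MeasurableSingletonClass ι]

lemma sum_restrict_preimage_singleton {f : E → ι} (hf : Measurable f) (ν : Measure E) :
    Measure.sum (fun c => ν.restrict (f ⁻¹' {c})) = ν := by
  rw [← Measure.restrict_iUnion (fun c c' h => Disjoint.preimage f (by simpa using h))
    (fun c => hf (measurableSet_singleton c))]
  rw [← Set.preimage_iUnion, Set.iUnion_of_singleton, Set.preimage_univ, Measure.restrict_univ]

lemma lintegral_comp_eq_tsum {f : E → ι} (hf : Measurable f) (ν : Measure E) (g : ι → ℝ≥0∞) :
    ∫⁻ x, g (f x) ∂ν = ∑' c, g c * ν (f ⁻¹' {c}) := by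
  rw [← lintegral_map (measurable_of_countable g) hf, lintegral_countable']
  exact tsum_congr fun c => by rw [Measure.map_apply hf (measurableSet_singleton c)]

lemma min_div_mul_add_tsub_div {a b : ℝ≥0∞} (ha : a ≠ ∞) (hb : b ≠ ∞) (ha0 : a ≠ 0) :
    min a b / (a * b) * b + (a - b) / a = 1 := by
  rcases eq_or_ne b 0 with rfl | hb0
  · simp [ENNReal.div_self ha0 ha]
  · have h1 : min a b / (a * b) * b = min a b / a := by
      rw [div_eq_mul_inv, div_eq_mul_inv, ENNReal.mul_inv (Or.inl ha0) (Or.inl ha), mul_assoc,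
        mul_assoc, ENNReal.inv_mul_cancel hb0 hb, mul_one]
    rw [h1, ← ENNReal.add_div, min_comm]
    rcases le_total a b with h | h
    · rw [min_eq_right h, tsub_eq_zero_of_le h, add_zero, ENNReal.div_self ha0 ha]
    · rw [min_eq_left h, add_tsub_cancel_of_le h, ENNReal.div_self ha0 ha]

/-- In every cell the common mass is coupled by a multiple of the product measure, so that only the
excess of one measure over the other remains. -/
lemma exists_partial_coupling {f : E → ι} (hf : Measurable f) (ν μ : Measure E)
    [IsFiniteMeasure ν] [IsFiniteMeasure μ] :
    ∃ (π : Measure (E × E)) (ν' μ' : Measure E), π.map Prod.fst + ν' = ν ∧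
      π.map Prod.snd + μ' = μ ∧ (∀ᵐ z ∂π, f z.1 = f z.2) ∧
      (∀ c, ν' (f ⁻¹' {c}) = ν (f ⁻¹' {c}) - μ (f ⁻¹' {c})) ∧
      ∀ c, μ' (f ⁻¹' {c}) = μ (f ⁻¹' {c}) - ν (f ⁻¹' {c}) := by
  set a : ι → ℝ≥0∞ := fun c => ν (f ⁻¹' {c}) with ha
  set b : ι → ℝ≥0∞ := fun c => μ (f ⁻¹' {c}) with hb
  have hF : ∀ c, MeasurableSet (f ⁻¹' {c}) := fun c => hf (measurableSet_singleton c)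
  have hat : ∀ c, a c ≠ ∞ := fun c => measure_ne_top _ _
  have hbt : ∀ c, b c ≠ ∞ := fun c => measure_ne_top _ _
  have hres : ∀ (ρ : Measure E) (k : ι → ℝ≥0∞) c,
      (Measure.sum fun c => k c • ρ.restrict (f ⁻¹' {c})) (f ⁻¹' {c}) = k c * ρ (f ⁻¹' {c}) := by
    intro ρ k c
    rw [Measure.sum_apply _ (hF c), tsum_eq_single c]
    · simp [Measure.restrict_apply (hF c)]
    · intro c' hc'
      rw [Measure.smul_apply, Measure.restrict_apply (hF c), ← Set.preimage_inter]
      simp [Set.singleton_inter_eq_empty.2 (show c ∉ ({c'} : Set ι) by simpa using hc'.symm)]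
  have hdiv : ∀ s t : ℝ≥0∞, s ≠ ∞ → (s - t) / s * s = s - t := by
    intro s t hs
    rcases eq_or_ne s 0 with rfl | hs0
    · simp
    · exact ENNReal.div_mul_cancel hs0 hs
  -- A cell that is null for either measure gets the coefficient `0 / 0 = 0`.
  refine ⟨Measure.sum fun c => (min (a c) (b c) / (a c * b c)) •
      (ν.restrict (f ⁻¹' {c})).prod (μ.restrict (f ⁻¹' {c})),
    Measure.sum fun c => ((a c - b c) / a c) • ν.restrict (f ⁻¹' {c}),
    Measure.sum fun c => ((b c - a c) / b c) • μ.restrict (f ⁻¹' {c}), ?_, ?_, ?_, ?_, ?_⟩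
  · rw [Measure.map_sum measurable_fst.aemeasurable, Measure.sum_add_sum]
    conv_rhs => rw [← sum_restrict_preimage_singleton hf ν]
    congr 1
    funext c
    rw [Measure.map_smul, Measure.map_fst_prod, Measure.restrict_apply_univ, smul_smul]
    rcases eq_or_ne (a c) 0 with h0 | h0
    · rw [Measure.restrict_eq_zero.2 h0]; simp
    · rw [← add_smul, min_div_mul_add_tsub_div (hat c) (hbt c) h0, one_smul]
  · rw [Measure.map_sum measurable_snd.aemeasurable, Measure.sum_add_sum]
    conv_rhs => rw [← sum_restrict_preimage_singleton hf μ]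
    congr 1
    funext c
    rw [Measure.map_smul, Measure.map_snd_prod, Measure.restrict_apply_univ, smul_smul]
    rcases eq_or_ne (b c) 0 with h0 | h0
    · rw [Measure.restrict_eq_zero.2 h0]; simp
    · rw [← add_smul, min_comm, mul_comm (a c) (b c),
        min_div_mul_add_tsub_div (hbt c) (hat c) h0, one_smul]
  · refine (Measure.ae_sum_iff' (measurableSet_eq_fun (hf.comp measurable_fst)
      (hf.comp measurable_snd))).2 fun c => ?_
    refine Measure.ae_smul_measure ?_ _
    rw [Measure.prod_restrict]
    filter_upwards [ae_restrict_mem ((hF c).prod (hF c))] with z hz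
    exact hz.1.trans hz.2.symm
  · intro c
    rw [hres]
    exact hdiv _ _ (hat c)
  · intro c
    rw [hres]
    exact hdiv _ _ (hbt c)

lemma exists_partial_coupling_lintegral_le {f : E → ι} (hf : Measurable f) (ν μ : Measure E)
    [IsFiniteMeasure ν] [IsFiniteMeasure μ] (h : ν Set.univ = μ Set.univ) {c : E × E → ℝ≥0∞}
    {g : E → ℝ≥0∞} (hg : Measurable g) (hcg : ∀ x y, f x = f y → c (x, y) ≤ g x) :
    ∃ (π : Measure (E × E)) (ν' μ' : Measure E), IsFiniteMeasure π ∧ IsFiniteMeasure ν' ∧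
      IsFiniteMeasure μ' ∧ ν' Set.univ = μ' Set.univ ∧ π.map Prod.fst + ν' = ν ∧
      π.map Prod.snd + μ' = μ ∧ (∀ᵐ z ∂π, f z.1 = f z.2) ∧
      (∀ c, ν' (f ⁻¹' {c}) = ν (f ⁻¹' {c}) - μ (f ⁻¹' {c})) ∧
      (∀ c, μ' (f ⁻¹' {c}) = μ (f ⁻¹' {c}) - ν (f ⁻¹' {c})) ∧
      ∫⁻ z, c z ∂π ≤ ∫⁻ x, g x ∂ν := by
  obtain ⟨π, ν', μ', h₁, h₂, hπ, hν', hμ'⟩ := exists_partial_coupling hf ν μ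
  have hle : π.map Prod.fst ≤ ν := h₁ ▸ Measure.le_add_right le_rfl
  have hπu : π Set.univ = π.map Prod.fst Set.univ := by
    rw [Measure.map_apply measurable_fst MeasurableSet.univ, Set.preimage_univ]
  have : IsFiniteMeasure π := ⟨by rw [hπu]; exact (hle _).trans_lt (measure_lt_top ν Set.univ)⟩
  refine ⟨π, ν', μ', this, isFiniteMeasure_of_le ν (h₁ ▸ Measure.le_add_left le_rfl),
    isFiniteMeasure_of_le μ (h₂ ▸ Measure.le_add_left le_rfl), ?_, h₁, h₂, hπ, hν', hμ', ?_⟩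
  · have e1 : π Set.univ + ν' Set.univ = π Set.univ + μ' Set.univ := by
      conv_lhs => rw [hπu, ← Measure.add_apply, h₁, h, ← h₂, Measure.add_apply]
      rw [Measure.map_apply measurable_snd MeasurableSet.univ, Set.preimage_univ]
    exact (ENNReal.add_right_inj (measure_ne_top _ _)).1 e1
  · calc ∫⁻ z, c z ∂π ≤ ∫⁻ z, g z.1 ∂π := by
          refine lintegral_mono_ae ?_
          filter_upwards [hπ] with z hz using hcg _ _ hz
      _ = ∫⁻ x, g x ∂(π.map Prod.fst) := (lintegral_map hg measurable_fst).symm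
      _ ≤ _ := lintegral_mono' hle le_rfl

/-- The normalised product measure suffices; it disposes of the mass left over at the coarsest
level. -/
lemma exists_coupling_add {ν μ : Measure E} [IsFiniteMeasure ν] [IsFiniteMeasure μ]
    (h : ν Set.univ = μ Set.univ) {c : E × E → ℝ≥0∞} (hc : Measurable c)
    {k : E → ℝ≥0∞} (hk : Measurable k) (hck : ∀ x y, c (x, y) ≤ k x + k y) :
    ∃ π : Measure (E × E), π.map Prod.fst = ν ∧ π.map Prod.snd = μ ∧
      ∫⁻ z, c z ∂π ≤ ∫⁻ x, k x ∂ν + ∫⁻ y, k y ∂μ := by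
  rcases eq_or_ne (ν Set.univ) 0 with h0 | h0
  · refine ⟨0, ?_, ?_, by simp⟩
    · simp [Measure.measure_univ_eq_zero.1 h0]
    · simp [Measure.measure_univ_eq_zero.1 (h ▸ h0)]
  · have ht : ν Set.univ ≠ ∞ := measure_ne_top _ _
    refine ⟨(ν Set.univ)⁻¹ • ν.prod μ, ?_, ?_, ?_⟩
    · rw [Measure.map_smul, Measure.map_fst_prod, smul_smul, ← h, ENNReal.inv_mul_cancel h0 ht,
        one_smul]
    · rw [Measure.map_smul, Measure.map_snd_prod, smul_smul, ENNReal.inv_mul_cancel h0 ht,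
        one_smul]
    · rw [lintegral_smul_measure, lintegral_prod _ hc.aemeasurable, smul_eq_mul]
      calc (ν Set.univ)⁻¹ * ∫⁻ x, ∫⁻ y, c (x, y) ∂μ ∂ν
          ≤ (ν Set.univ)⁻¹ * ∫⁻ x, ∫⁻ y, (k x + k y) ∂μ ∂ν := by
            gcongr; exact hck _ _
        _ = (ν Set.univ)⁻¹ * (ν Set.univ * (∫⁻ x, k x ∂ν + ∫⁻ y, k y ∂μ)) := by
            congr 1
            simp_rw [lintegral_add_left measurable_const, lintegral_const]
            rw [lintegral_add_right _ measurable_const, lintegral_mul_const _ hk, lintegral_const,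
              ← h, mul_add, mul_comm, mul_comm (ν Set.univ) (∫⁻ y, k y ∂μ)]
        _ ≤ _ := by
            rw [← mul_assoc, ENNReal.inv_mul_cancel h0 ht, one_mul]

omit [Countable ι] in
-- Mass matched within cells contributes equally to both measures of a cell and cancels. Hence
-- matching at a fine level leaves the discrepancies of all coarser levels unchanged.
lemma tsub_eq_tsub_of_partial_coupling {π : Measure (E × E)} [IsFiniteMeasure π]
    {ν μ ν' μ' : Measure E} (h₁ : π.map Prod.fst + ν' = ν) (h₂ : π.map Prod.snd + μ' = μ)
    {f : E → ι} (hf : Measurable f) (hπ : ∀ᵐ z ∂π, f z.1 = f z.2) (c : ι) :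
    ν' (f ⁻¹' {c}) - μ' (f ⁻¹' {c}) = ν (f ⁻¹' {c}) - μ (f ⁻¹' {c}) ∧
    μ' (f ⁻¹' {c}) - ν' (f ⁻¹' {c}) = μ (f ⁻¹' {c}) - ν (f ⁻¹' {c}) := by
  have hF : MeasurableSet (f ⁻¹' {c}) := hf (measurableSet_singleton c)
  have he : π.map Prod.fst (f ⁻¹' {c}) = π.map Prod.snd (f ⁻¹' {c}) := by
    rw [Measure.map_apply measurable_fst hF, Measure.map_apply measurable_snd hF]
    refine measure_congr ?_
    filter_upwards [hπ] with z hz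
    exact propext ⟨fun h => hz.symm.trans h, fun h => hz.trans h⟩
  have hfin : π.map Prod.snd (f ⁻¹' {c}) ≠ ∞ := measure_ne_top _ _
  rw [← h₁, ← h₂, Measure.add_apply, Measure.add_apply, he]
  exact ⟨(ENNReal.add_sub_add_eq_sub_left hfin).symm, (ENNReal.add_sub_add_eq_sub_left hfin).symm⟩

/-- Multiscale bound on the optimal transport cost: mass is matched inside the cells of the finest
partition first, the rest inside the cells of the next coarser one, and so on. -/
lemma exists_coupling_of_nested_partitions {f : ℕ → E → ι} (hf : ∀ l, Measurable (f l))
    (hnest : ∀ l x y, f (l + 1) x = f (l + 1) y → f l x = f l y)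
    {c : E × E → ℝ≥0∞} (hc : Measurable c) {δ : ℕ → ι → ℝ≥0∞} {k : ι → ℝ≥0∞}
    (hδ : ∀ l x y, f l x = f l y → c (x, y) ≤ δ l (f (l + 1) x))
    (hk : ∀ x y, c (x, y) ≤ k (f 0 x) + k (f 0 y)) (L : ℕ) (ν μ : Measure E)
    [IsFiniteMeasure ν] [IsFiniteMeasure μ] (h : ν Set.univ = μ Set.univ) :
    ∃ π : Measure (E × E), π.map Prod.fst = ν ∧ π.map Prod.snd = μ ∧
      ∫⁻ z, c z ∂π ≤ ∫⁻ x, δ L (f (L + 1) x) ∂ν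
        + ∑ l ∈ Finset.range L, ∑' i, δ l i * (ν (f (l + 1) ⁻¹' {i}) - μ (f (l + 1) ⁻¹' {i}))
        + ∑' i, k i * ((ν (f 0 ⁻¹' {i}) - μ (f 0 ⁻¹' {i}))
          + (μ (f 0 ⁻¹' {i}) - ν (f 0 ⁻¹' {i}))) := by
  have hnest' : ∀ l l' x y, l ≤ l' → f l' x = f l' y → f l x = f l y := by
    intro l l' x y hl
    induction l', hl using Nat.le_induction with
    | base => exact id
    | succ m _ ih => exact fun h => ih (hnest m x y h)
  induction L generalizing ν μ with
  | zero =>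
    obtain ⟨π, ν', μ', _, _, _, hmass, h₁, h₂, hπ, hν', hμ', hle⟩ :=
      exists_partial_coupling_lintegral_le (hf 0) ν μ h
        ((measurable_of_countable (δ 0)).comp (hf 1)) (hδ 0)
    obtain ⟨π', h₁', h₂', hcost⟩ := exists_coupling_add hmass hc
      ((measurable_of_countable k).comp (hf 0)) hk
    refine ⟨π + π', ?_, ?_, ?_⟩
    · rw [Measure.map_add _ _ measurable_fst, h₁', h₁]
    · rw [Measure.map_add _ _ measurable_snd, h₂', h₂]
    · rw [lintegral_add_measure, Finset.range_zero, Finset.sum_empty, add_zero]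
      refine add_le_add hle (hcost.trans (le_of_eq ?_))
      simp only [Function.comp_apply]
      rw [lintegral_comp_eq_tsum (hf 0), lintegral_comp_eq_tsum (hf 0), ← ENNReal.tsum_add]
      exact tsum_congr fun i => by rw [hν', hμ', mul_add]
  | succ L ih =>
    obtain ⟨π, ν', μ', _, _, _, hmass, h₁, h₂, hπ, hν', hμ', hle⟩ :=
      exists_partial_coupling_lintegral_le (hf (L + 1)) ν μ h
        ((measurable_of_countable (δ (L + 1))).comp (hf (L + 2))) (hδ (L + 1))
    -- The induction hypothesis is applied to the unmatched remainders, which is why `ν` and `μ` are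
    -- generalised.
    obtain ⟨π', h₁', h₂', hcost⟩ := ih ν' μ' hmass
    have hdiff : ∀ l, l ≤ L + 1 → ∀ i, _ := fun l hl i =>
      tsub_eq_tsub_of_partial_coupling h₁ h₂ (hf l)
        (hπ.mono fun z hz => hnest' l (L + 1) _ _ hl hz) i
    refine ⟨π + π', ?_, ?_, ?_⟩
    · rw [Measure.map_add _ _ measurable_fst, h₁', h₁]
    · rw [Measure.map_add _ _ measurable_snd, h₂', h₂]
    · rw [lintegral_add_measure, Finset.sum_range_succ, add_assoc (∫⁻ x, _ ∂ν)]
      refine add_le_add hle (hcost.trans (le_of_eq ?_))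
      -- The leading integral for the remainder `ν'` is a sum over cells of level `L + 1`, on which
      -- `ν'` has the mass of the truncated difference; it is the new summand `l = L`. This is why
      -- `δ l` is indexed by cells of level `l + 1`.
      rw [lintegral_comp_eq_tsum (hf (L + 1))]
      simp_rw [hν']
      rw [add_comm (∑' i, δ L i * _)]
      congr 2
      · refine Finset.sum_congr rfl fun l hl => tsum_congr fun i => ?_
        rw [(hdiff (l + 1) (by have := Finset.mem_range.1 hl; omega) i).1]
      · funext i
        rw [(hdiff 0 (by omega) i).1, (hdiff 0 (by omega) i).2]

/-- Let the depth tend to infinity: the cost of matching inside the finest cells vanishes by `hlim`.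
-/
lemma iInf_coupling_le_of_nested_partitions {f : ℕ → E → ι} (hf : ∀ l, Measurable (f l))
    (hnest : ∀ l x y, f (l + 1) x = f (l + 1) y → f l x = f l y)
    {c : E × E → ℝ≥0∞} (hc : Measurable c) {δ : ℕ → ι → ℝ≥0∞} {k : ι → ℝ≥0∞}
    (hδ : ∀ l x y, f l x = f l y → c (x, y) ≤ δ l (f (l + 1) x))
    (hk : ∀ x y, c (x, y) ≤ k (f 0 x) + k (f 0 y)) (ν μ : Measure E)
    [IsProbabilityMeasure ν] [IsProbabilityMeasure μ]
    (hlim : Tendsto (fun L => ∫⁻ x, δ L (f (L + 1) x) ∂ν) atTop (𝓝 0)) :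
    ⨅ π ∈ measureCouplings ν μ, ∫⁻ z, c z ∂π ≤
      ∑' l, ∑' i, δ l i * (ν (f (l + 1) ⁻¹' {i}) - μ (f (l + 1) ⁻¹' {i}))
        + ∑' i, k i * ((ν (f 0 ⁻¹' {i}) - μ (f 0 ⁻¹' {i}))
          + (μ (f 0 ⁻¹' {i}) - ν (f 0 ⁻¹' {i}))) := by
  set A := ∑' l, ∑' i, δ l i * (ν (f (l + 1) ⁻¹' {i}) - μ (f (l + 1) ⁻¹' {i}))
  set B := ∑' i, k i * ((ν (f 0 ⁻¹' {i}) - μ (f 0 ⁻¹' {i}))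
          + (μ (f 0 ⁻¹' {i}) - ν (f 0 ⁻¹' {i})))
  have key : ∀ L, ⨅ π ∈ measureCouplings ν μ, ∫⁻ z, c z ∂π
      ≤ ∫⁻ x, δ L (f (L + 1) x) ∂ν + (A + B) := by
    intro L
    obtain ⟨π, h₁, h₂, hcost⟩ := exists_coupling_of_nested_partitions hf hnest hc hδ hk L ν μ
      (by simp)
    have hπ : π ∈ measureCouplings ν μ := by
      refine ⟨⟨?_⟩, h₁, h₂⟩
      have : π Set.univ = π.map Prod.fst Set.univ := by
        rw [Measure.map_apply measurable_fst MeasurableSet.univ, Set.preimage_univ]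
      rw [this, h₁, measure_univ]
    refine (iInf₂_le π hπ).trans (hcost.trans ?_)
    rw [← add_assoc]
    gcongr
    exact ENNReal.sum_le_tsum _
  refine ge_of_tendsto (x := atTop) (f := fun L => ∫⁻ x, δ L (f (L + 1) x) ∂ν + (A + B)) ?_
    (Eventually.of_forall key)
  simpa using hlim.add_const (A + B)

end TreeCoupling

/-! ### Bounded measurable functions, a class closed under the operations used below and always
integrable -/

section BoundedMeasurable

/-- Bounded measurable real functions. -/
def BddMeasurable {α : Type*} [MeasurableSpace α] (f : α → ℝ) : Prop :=
  Measurable f ∧ ∃ C, ∀ x, |f x| ≤ C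

namespace BddMeasurable

variable {α β : Type*} [MeasurableSpace α] [MeasurableSpace β] {f g : α → ℝ}

lemma const (c : ℝ) : BddMeasurable fun _ : α => c := ⟨measurable_const, |c|, fun _ => le_rfl⟩

lemma integrable (hf : BddMeasurable f) (μ : Measure α) [IsFiniteMeasure μ] : Integrable f μ := by
  obtain ⟨C, hC⟩ := hf.2
  exact Integrable.of_bound hf.1.aestronglyMeasurable C (Eventually.of_forall hC)

lemma add (hf : BddMeasurable f) (hg : BddMeasurable g) : BddMeasurable fun x => f x + g x := by
  obtain ⟨C, hC⟩ := hf.2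
  obtain ⟨D, hD⟩ := hg.2
  exact ⟨hf.1.add hg.1, C + D, fun x => (abs_add_le _ _).trans (add_le_add (hC x) (hD x))⟩

lemma neg (hf : BddMeasurable f) : BddMeasurable fun x => -f x := by
  obtain ⟨C, hC⟩ := hf.2
  exact ⟨hf.1.neg, C, fun x => (abs_neg (f x)).trans_le (hC x)⟩

lemma sub (hf : BddMeasurable f) (hg : BddMeasurable g) : BddMeasurable fun x => f x - g x := by
  simpa only [sub_eq_add_neg] using hf.add hg.neg

lemma mul (hf : BddMeasurable f) (hg : BddMeasurable g) : BddMeasurable fun x => f x * g x := by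
  obtain ⟨C, hC⟩ := hf.2
  obtain ⟨D, hD⟩ := hg.2
  refine ⟨hf.1.mul hg.1, C * D, fun x => ?_⟩
  rw [abs_mul]
  exact mul_le_mul (hC x) (hD x) (abs_nonneg _) ((abs_nonneg _).trans (hC x))

lemma abs (hf : BddMeasurable f) : BddMeasurable fun x => |f x| := by
  obtain ⟨C, hC⟩ := hf.2
  exact ⟨continuous_abs.measurable.comp hf.1, C, fun x => (abs_abs (f x)).trans_le (hC x)⟩

lemma sup (hf : BddMeasurable f) (hg : BddMeasurable g) : BddMeasurable fun x => f x ⊔ g x := by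
  obtain ⟨C, hC⟩ := hf.2
  obtain ⟨D, hD⟩ := hg.2
  exact ⟨hf.1.sup hg.1, C ⊔ D, fun x => abs_max_le_max_abs_abs.trans (sup_le_sup (hC x) (hD x))⟩

lemma pow (hf : BddMeasurable f) (k : ℕ) : BddMeasurable fun x => f x ^ k := by
  obtain ⟨C, hC⟩ := hf.2
  exact ⟨hf.1.pow_const k, C ^ k, fun x => by
    rw [abs_pow]; exact pow_le_pow_left₀ (abs_nonneg _) (hC x) k⟩

lemma rpow (hf : BddMeasurable f) {r : ℝ} (hr : 0 ≤ r) : BddMeasurable fun x => |f x| ^ r := by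
  obtain ⟨C, hC⟩ := hf.2
  refine ⟨hf.abs.1.pow_const r, C ^ r, fun x => ?_⟩
  rw [abs_of_nonneg (Real.rpow_nonneg (abs_nonneg _) _)]
  exact Real.rpow_le_rpow (abs_nonneg _) (hC x) hr

lemma comp (hf : BddMeasurable f) {φ : β → α} (hφ : Measurable φ) :
    BddMeasurable fun x => f (φ x) := by
  obtain ⟨C, hC⟩ := hf.2
  exact ⟨hf.1.comp hφ, C, fun x => hC _⟩

lemma sum {κ : Type*} (s : Finset κ) {f : κ → α → ℝ} (hf : ∀ i ∈ s, BddMeasurable (f i)) :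
    BddMeasurable fun x => ∑ i ∈ s, f i x := by
  classical
  induction s using Finset.induction_on with
  | empty => simpa using const 0
  | insert a s ha ih =>
    simp only [Finset.sum_insert ha]
    exact (hf a (Finset.mem_insert_self _ _)).add
      (ih fun i hi => hf i (Finset.mem_insert_of_mem hi))

lemma indicator_one {s : Set α} (hs : MeasurableSet s) :
    BddMeasurable (s.indicator fun _ => (1 : ℝ)) := by
  refine ⟨measurable_const.indicator hs, 1, fun x => ?_⟩
  by_cases hx : x ∈ s <;> simp [hx]

lemma integral_right (ν : Measure β) [IsProbabilityMeasure ν] {f : α × β → ℝ}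
    (hf : BddMeasurable f) : BddMeasurable fun x => ∫ y, f (x, y) ∂ν := by
  obtain ⟨C, hC⟩ := hf.2
  refine ⟨hf.1.stronglyMeasurable.integral_prod_right'.measurable, C, fun x => ?_⟩
  have := norm_integral_le_of_norm_le_const (μ := ν) (f := fun y => f (x, y)) (C := C)
    (Eventually.of_forall fun y => hC _)
  simpa using this

end BddMeasurable

end BoundedMeasurable

/-! ### Integrating out the last coordinate of a product -/

section ProductMeasure

variable {E : Type*} [MeasurableSpace E] {n : ℕ}

lemma measurable_snoc :
    Measurable fun z : (Fin n → E) × E => (Fin.snoc z.1 z.2 : Fin (n + 1) → E) := by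
  refine measurable_pi_lambda _ fun i => ?_
  refine Fin.lastCases ?_ (fun j => ?_) i
  · simpa using measurable_snd
  · simp only [Fin.snoc_castSucc]
    exact (measurable_pi_apply j).comp measurable_fst

lemma measurable_snoc_right (x : Fin n → E) :
    Measurable fun y : E => (Fin.snoc x y : Fin (n + 1) → E) :=
  measurable_snoc.comp measurable_prodMk_left

lemma integral_pi_snoc (μ : Measure E) [IsProbabilityMeasure μ] {F : (Fin (n + 1) → E) → ℝ}
    (hF : BddMeasurable F) :
    ∫ z, F z ∂(Measure.pi fun _ => μ) =
      ∫ x : Fin n → E, ∫ y, F (Fin.snoc x y) ∂μ ∂(Measure.pi fun _ => μ) := by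
  have hmp := (measurePreserving_piFinSuccAbove (fun _ : Fin (n + 1) => μ) (Fin.last n)).symm
  rw [← hmp.integral_comp']
  have h : ∀ z : E × (Fin n → E),
      (MeasurableEquiv.piFinSuccAbove (fun _ : Fin (n + 1) => E) (Fin.last n)).symm z
        = Fin.snoc z.2 z.1 := by
    intro z
    rw [← Fin.insertNth_last']
    rfl
  simp_rw [h]
  rw [integral_prod_symm (f := fun z : E × (Fin n → E) => F (Fin.snoc z.2 z.1))]
  exact (hF.comp (measurable_snoc.comp measurable_swap)).integrable _

end ProductMeasure

/-! ### A von Bahr–Esseen inequality for functions of independent variables -/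

section VonBahrEsseen

lemma abs_one_add_rpow_le {r : ℝ} (hr₁ : 1 < r) (hr₂ : r < 2) (t : ℝ) :
    |1 + t| ^ r ≤ 1 + r * t + 4 * |t| ^ r := by
  rcases le_total t (-1) with ht | ht
  · have h1 : |1 + t| ≤ |t| := by
      rw [abs_of_nonpos (by linarith), abs_of_nonpos (by linarith)]; linarith
    have h2 : |1 + t| ^ r ≤ |t| ^ r := Real.rpow_le_rpow (abs_nonneg _) h1 (by linarith)
    have h3 : |t| ≤ |t| ^ r := by
      refine Real.self_le_rpow_of_one_le ?_ hr₁.le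
      rw [abs_of_nonpos (by linarith)]; linarith
    have h4 : |t| = -t := abs_of_nonpos (by linarith)
    nlinarith
  · rcases le_total t 1 with ht' | ht'
    · rw [abs_of_nonneg (by linarith : 0 ≤ 1 + t)]
      -- Bernoulli's inequality for the exponent `r - 1 < 1` bounds this product by `1 + r * t + (r
      -- - 1) * t ^ 2`, and `t ^ 2 ≤ |t| ^ r` for `|t| ≤ 1`.
      have h1 : (1 + t) ^ r = (1 + t) * (1 + t) ^ (r - 1) := by
        rcases eq_or_lt_of_le (by linarith : 0 ≤ 1 + t) with h0 | h0
        · rw [← h0, Real.zero_rpow (by linarith), zero_mul]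
        · conv_rhs => rw [← Real.rpow_one (1 + t), ← Real.rpow_mul (by linarith), one_mul,
            ← Real.rpow_add h0]
          congr 1; ring
      have h2 : (1 + t) ^ (r - 1) ≤ 1 + (r - 1) * t :=
        rpow_one_add_le_one_add_mul_self ht (by linarith) (by linarith)
      have h3 : t ^ 2 ≤ |t| ^ r := by
        rw [← sq_abs, ← Real.rpow_natCast]
        rcases eq_or_lt_of_le (abs_nonneg t) with h0 | h0
        · rw [← h0, Real.zero_rpow (by norm_num), Real.zero_rpow (by linarith)]
        · exact Real.rpow_le_rpow_of_exponent_ge h0 (abs_le.2 ⟨ht, ht'⟩) (by push_cast; linarith)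
      rw [h1]
      nlinarith [mul_le_mul_of_nonneg_left h2 (by linarith : 0 ≤ 1 + t), sq_nonneg t]
    · have h1 : |1 + t| ^ r ≤ (2 * t) ^ r := by
        rw [abs_of_nonneg (by linarith)]
        exact Real.rpow_le_rpow (by linarith) (by linarith) (by linarith)
      rw [Real.mul_rpow (by norm_num) (by linarith)] at h1
      have h2 : (2 : ℝ) ^ r ≤ 4 := by
        calc (2 : ℝ) ^ r ≤ 2 ^ (2 : ℝ) := Real.rpow_le_rpow_of_exponent_le (by norm_num) hr₂.le
          _ = 4 := by norm_num
      rw [abs_of_nonneg (by linarith : 0 ≤ t)]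
      have h3 : 0 ≤ t ^ r := Real.rpow_nonneg (by linarith) _
      nlinarith

/-- A first-order expansion, obtained by homogeneity from the case `a = 1`. The coefficient of `b`
is the derivative of `|a| ^ r`, written so that division by zero gives its value `0` at `a = 0`;
only its independence of `b` matters later. -/
lemma abs_add_rpow_le {r : ℝ} (hr₁ : 1 < r) (hr₂ : r < 2) (a b : ℝ) :
    |a + b| ^ r ≤ |a| ^ r + (r * |a| ^ r / a) * b + 4 * |b| ^ r := by
  rcases eq_or_ne a 0 with rfl | ha
  · have : 0 ≤ |b| ^ r := Real.rpow_nonneg (abs_nonneg _) _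
    simp [Real.zero_rpow (by linarith : r ≠ 0)]
    linarith
  · have h := abs_one_add_rpow_le hr₁ hr₂ (b / a)
    have ha' : 0 ≤ |a| ^ r := Real.rpow_nonneg (abs_nonneg _) _
    have h1 : |a + b| ^ r = |a| ^ r * |1 + b / a| ^ r := by
      rw [← Real.mul_rpow (abs_nonneg _) (abs_nonneg _), ← abs_mul]
      congr 2; field_simp
    have h2 : |b| ^ r = |a| ^ r * |b / a| ^ r := by
      rw [← Real.mul_rpow (abs_nonneg _) (abs_nonneg _), ← abs_mul]
      congr 2; field_simp
    rw [h1, h2]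
    refine (mul_le_mul_of_nonneg_left h ha').trans (le_of_eq ?_)
    ring

lemma add_rpow_le_two_mul {r : ℝ} (hr₁ : 1 < r) (hr₂ : r < 2) {a b : ℝ} (ha : 0 ≤ a)
    (hb : 0 ≤ b) : (a + b) ^ r ≤ 2 * (a ^ r + b ^ r) := by
  lift a to ℝ≥0 using ha
  lift b to ℝ≥0 using hb
  have h : ((a : ℝ) + b) ^ r ≤ 2 ^ (r - 1) * ((a : ℝ) ^ r + (b : ℝ) ^ r) := by
    exact_mod_cast NNReal.rpow_add_le_mul_rpow_add_rpow a b hr₁.le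
  refine h.trans (mul_le_mul_of_nonneg_right ?_ (by positivity))
  calc (2 : ℝ) ^ (r - 1) ≤ 2 ^ (1 : ℝ) :=
        Real.rpow_le_rpow_of_exponent_le (by norm_num) (by linarith)
    _ = 2 := by norm_num

lemma rpow_integral_le {α : Type*} [MeasurableSpace α] {μ : Measure α} [IsProbabilityMeasure μ]
    {r : ℝ} (hr : 1 ≤ r) {g : α → ℝ} (hg : BddMeasurable g) (hg0 : ∀ x, 0 ≤ g x) :
    (∫ x, g x ∂μ) ^ r ≤ ∫ x, g x ^ r ∂μ := by
  have hi : Integrable (fun x => g x ^ r) μ := by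
    have := (hg.rpow (r := r) (by linarith)).integrable μ
    simpa only [abs_of_nonneg (hg0 _)] using this
  exact (convexOn_rpow hr).map_integral_le (Real.continuous_rpow_const (by linarith)).continuousOn
    isClosed_Ici (Eventually.of_forall fun x => hg0 x) (hg.integrable μ) hi

/-- Concentration of a function with bounded differences `g (x i) + g y`, in `L^r` for
`1 < r < 2`. -/
lemma integral_abs_sub_integral_rpow_le {E : Type*} [MeasurableSpace E] (μ : Measure E)
    [IsProbabilityMeasure μ] {r : ℝ} (hr₁ : 1 < r) (hr₂ : r < 2) {g : E → ℝ}
    (hg : BddMeasurable g) (hg0 : ∀ x, 0 ≤ g x) {n : ℕ} {F : (Fin n → E) → ℝ}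
    (hF : BddMeasurable F)
    (hFg : ∀ x i y, |F x - F (Function.update x i y)| ≤ g (x i) + g y) :
    ∫ x, |F x - ∫ z, F z ∂(Measure.pi fun _ => μ)| ^ r ∂(Measure.pi fun _ => μ)
      ≤ 16 * n * ∫ y, g y ^ r ∂μ := by
  induction n with
  | zero =>
    have hc : ∀ x, F x = F default := fun x => by rw [Subsingleton.elim x default]
    simp only [hc, integral_const, probReal_univ, one_smul, sub_self, abs_zero,
      Real.zero_rpow (by linarith : r ≠ 0)]
    simp
  | succ n ih =>
    -- `G` is the conditional expectation of `F` given the first `n` points. It has the same mean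
    -- and the same bounded differences, so the induction applies to it.
    set G : (Fin n → E) → ℝ := fun x => ∫ y, F (Fin.snoc x y) ∂μ with hGdef
    have hFs : BddMeasurable fun z : (Fin n → E) × E => F (Fin.snoc z.1 z.2) :=
      hF.comp measurable_snoc
    have hG : BddMeasurable G := hFs.integral_right μ
    have hFy : ∀ x : Fin n → E, BddMeasurable fun y => F (Fin.snoc x y) :=
      fun x => hF.comp (measurable_snoc_right x)
    have hgr : BddMeasurable fun y => g y ^ r := by
      simpa only [abs_of_nonneg (hg0 _)] using hg.rpow (r := r) (by linarith)
    have hgi := hg.integrable μ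
    set m := ∫ y, g y ∂μ with hm
    have hGg : ∀ x i y, |G x - G (Function.update x i y)| ≤ g (x i) + g y := by
      intro x i y
      rw [hGdef]
      simp only
      rw [← integral_sub ((hFy _).integrable μ) ((hFy _).integrable μ)]
      have := norm_integral_le_of_norm_le_const (μ := μ)
        (f := fun w => F (Fin.snoc x w) - F (Fin.snoc (Function.update x i y) w))
        (C := g (x i) + g y) (Eventually.of_forall fun w => by
          rw [Fin.snoc_update]
          have := hFg (Fin.snoc x w) i.castSucc y
          rwa [Fin.snoc_castSucc] at this)
      simpa using this
    have hEF : ∫ z, F z ∂(Measure.pi fun _ => μ) = ∫ x, G x ∂(Measure.pi fun _ => μ) :=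
      integral_pi_snoc μ hF
    set e := ∫ x, G x ∂(Measure.pi fun _ => μ) with he
    rw [hEF]
    have hFe : BddMeasurable fun z => |F z - e| ^ r := (hF.sub (.const e)).rpow (by linarith)
    have hGe : BddMeasurable fun z => |G z - e| ^ r := (hG.sub (.const e)).rpow (by linarith)
    rw [integral_pi_snoc μ hFe]
    have hdiff : ∀ x y, |F (Fin.snoc x y) - G x| ≤ g y + m := by
      intro x y
      have h1 : F (Fin.snoc x y) - G x = ∫ w, (F (Fin.snoc x y) - F (Fin.snoc x w)) ∂μ := by
        rw [integral_sub (integrable_const _) ((hFy x).integrable μ)]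
        simp [hGdef]
      have h2 : g y + m = ∫ w, (g y + g w) ∂μ := by
        rw [integral_add (integrable_const _) hgi]; simp [hm]
      rw [h1, h2]
      refine norm_integral_le_of_norm_le (f := fun w => F (Fin.snoc x y) - F (Fin.snoc x w))
        ((integrable_const _).add hgi) (Eventually.of_forall fun w => ?_)
      have := hFg (Fin.snoc x y) (Fin.last n) w
      rwa [Fin.snoc_last, Fin.update_snoc_last] at this
    have hm0 : 0 ≤ m := integral_nonneg hg0
    have hinner : ∀ x, ∫ y, |F (Fin.snoc x y) - e| ^ r ∂μ
        ≤ |G x - e| ^ r + 16 * ∫ y, g y ^ r ∂μ := by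
      intro x
      -- The linear term is a martingale increment and integrates to zero. The factor `8` is `4 *
      -- 2`, and Jensen's inequality for `m ^ r` doubles it to `16`.
      have hpt : ∀ y, |F (Fin.snoc x y) - e| ^ r ≤ |G x - e| ^ r
          + (r * |G x - e| ^ r / (G x - e)) * (F (Fin.snoc x y) - G x)
          + 8 * (g y ^ r + m ^ r) := by
        intro y
        have h1 := abs_add_rpow_le hr₁ hr₂ (G x - e) (F (Fin.snoc x y) - G x)
        have h2 : |F (Fin.snoc x y) - G x| ^ r ≤ 2 * (g y ^ r + m ^ r) := by
          refine (Real.rpow_le_rpow (abs_nonneg _) (hdiff x y) (by linarith)).trans ?_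
          exact add_rpow_le_two_mul hr₁ hr₂ (hg0 y) hm0
        have h3 : G x - e + (F (Fin.snoc x y) - G x) = F (Fin.snoc x y) - e := by ring
        rw [h3] at h1
        linarith
      have hi1 : Integrable (fun y => F (Fin.snoc x y) - G x) μ :=
        ((hFy x).sub (.const _)).integrable μ
      have hi2 : Integrable (fun y => g y ^ r + m ^ r) μ := (hgr.add (.const _)).integrable μ
      have hz : ∫ y, (F (Fin.snoc x y) - G x) ∂μ = 0 := by
        rw [integral_sub ((hFy x).integrable μ) (integrable_const _)]
        simp [hGdef]
      have hi3 : Integrable (fun y => |G x - e| ^ r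
          + (r * |G x - e| ^ r / (G x - e)) * (F (Fin.snoc x y) - G x)) μ :=
        (integrable_const _).add (hi1.const_mul _)
      calc ∫ y, |F (Fin.snoc x y) - e| ^ r ∂μ
          ≤ ∫ y, (|G x - e| ^ r
          + (r * |G x - e| ^ r / (G x - e)) * (F (Fin.snoc x y) - G x)
          + 8 * (g y ^ r + m ^ r)) ∂μ := by
            refine integral_mono ((hFe.comp (measurable_snoc_right x)).integrable μ) ?_ hpt
            exact hi3.add (hi2.const_mul _)
        _ = |G x - e| ^ r + 8 * (∫ y, g y ^ r ∂μ + m ^ r) := by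
            rw [integral_add hi3 (hi2.const_mul _),
              integral_add (integrable_const _) (hi1.const_mul _), integral_const_mul, hz,
              integral_const_mul, integral_add (hgr.integrable μ) (integrable_const _)]
            simp
        _ ≤ _ := by
            have := rpow_integral_le (μ := μ) hr₁.le hg hg0
            rw [← hm] at this
            linarith
    calc ∫ x : Fin n → E, ∫ y, |F (Fin.snoc x y) - e| ^ r ∂μ ∂(Measure.pi fun _ => μ)
        ≤ ∫ x : Fin n → E, (|G x - e| ^ r + 16 * ∫ y, g y ^ r ∂μ) ∂(Measure.pi fun _ => μ) := by
          refine integral_mono ?_ ((hGe.integrable _).add (integrable_const _)) hinner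
          exact (BddMeasurable.integral_right μ (hFe.comp measurable_snoc)).integrable _
      _ = ∫ x : Fin n → E, |G x - e| ^ r ∂(Measure.pi fun _ => μ)
          + 16 * ∫ y, g y ^ r ∂μ := by
          rw [integral_add (hGe.integrable _) (integrable_const _)]; simp
      _ ≤ _ := by
          have := ih hG hGg
          push_cast
          linarith

end VonBahrEsseen

/-! ### Kolmogorov's maximal inequality -/

section Maximal

variable {E : Type*} {n : ℕ}

/-- The sum of `ξ (x i)` over the first `k` coordinates of `x`. -/
def partialSum (ξ : E → ℝ) (x : Fin n → E) (k : ℕ) : ℝ := ∑ i, if i.val < k then ξ (x i) else 0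

lemma partialSum_snoc_of_le (ξ : E → ℝ) (x : Fin n → E) (y : E) {k : ℕ} (hk : k ≤ n) :
    partialSum ξ (Fin.snoc x y : Fin (n + 1) → E) k = partialSum ξ x k := by
  simp [partialSum, Fin.sum_univ_castSucc, hk.not_gt]

lemma partialSum_snoc_succ (ξ : E → ℝ) (x : Fin n → E) (y : E) :
    partialSum ξ (Fin.snoc x y : Fin (n + 1) → E) (n + 1) = partialSum ξ x n + ξ y := by
  simp only [partialSum, Fin.sum_univ_castSucc, Fin.snoc_castSucc, Fin.snoc_last, Fin.val_castSucc,
    Fin.val_last, lt_add_iff_pos_right, zero_lt_one, if_true]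
  congr 1
  refine Finset.sum_congr rfl fun i _ => ?_
  rw [if_pos i.isLt, if_pos (by omega)]

lemma abs_partialSum_sub_update_le (ξ : E → ℝ) (x : Fin n → E) (i : Fin n) (y : E) (k : ℕ) :
    |partialSum ξ x k - partialSum ξ (Function.update x i y) k| ≤ |ξ (x i) - ξ y| := by
  have h : partialSum ξ x k - partialSum ξ (Function.update x i y) k
      = if i.val < k then ξ (x i) - ξ y else 0 := by
    rw [partialSum, partialSum, ← Finset.sum_sub_distrib, Finset.sum_eq_single i]
    · by_cases hk : i.val < k <;> simp [hk]
    · intro j _ hj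
      simp [Function.update_of_ne hj]
    · simp
  rw [h]
  split_ifs
  · exact le_rfl
  · simp

variable [MeasurableSpace E]

lemma bddMeasurable_partialSum {ξ : E → ℝ} (hξ : BddMeasurable ξ) (k : ℕ) :
    BddMeasurable fun x : Fin n → E => partialSum ξ x k := by
  refine BddMeasurable.sum _ fun i _ => ?_
  split_ifs
  · exact hξ.comp (measurable_pi_apply i)
  · exact .const 0

lemma integral_partialSum_sq (μ : Measure E) [IsProbabilityMeasure μ] {ξ : E → ℝ}
    (hξ : BddMeasurable ξ) (h0 : ∫ y, ξ y ∂μ = 0) :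
    ∫ x : Fin n → E, partialSum ξ x n ^ 2 ∂(Measure.pi fun _ => μ) = n * ∫ y, ξ y ^ 2 ∂μ := by
  induction n with
  | zero => simp [partialSum]
  | succ n ih =>
    rw [integral_pi_snoc μ ((bddMeasurable_partialSum hξ _).pow 2)]
    have hin : ∀ x : Fin n → E, ∫ y, partialSum ξ (Fin.snoc x y : Fin (n + 1) → E) (n + 1) ^ 2 ∂μ
        = partialSum ξ x n ^ 2 + ∫ y, ξ y ^ 2 ∂μ := by
      intro x
      have hsq : ∀ y, partialSum ξ (Fin.snoc x y : Fin (n + 1) → E) (n + 1) ^ 2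
          = partialSum ξ x n ^ 2 + 2 * partialSum ξ x n * ξ y + ξ y ^ 2 := by
        intro y
        rw [partialSum_snoc_succ]; ring
      simp_rw [hsq]
      have h1 := (hξ.integrable μ).const_mul (2 * partialSum ξ x n)
      have h2 : Integrable (fun y => partialSum ξ x n ^ 2 + 2 * partialSum ξ x n * ξ y) μ :=
        (integrable_const _).add h1
      rw [integral_add h2 ((hξ.pow 2).integrable μ), integral_add (integrable_const _) h1,
        integral_const_mul, h0]
      simp
    simp_rw [hin]
    rw [integral_add (((bddMeasurable_partialSum hξ _).pow 2).integrable _) (integrable_const _), ih]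
    simp
    ring

/-- For the running maximum `M` of `|S_k|`, the process `M ^ 2 - 2 * M * |S|` is a supermartingale:
updating `M` costs nothing by `(M - |S|) ^ 2 ≥ 0`, and `|S|` is a submartingale. This replaces
stopping times by an induction on the number of points. -/
lemma exists_maximal_bound_aux (μ : Measure E) [IsProbabilityMeasure μ] {ξ : E → ℝ}
    (hξ : BddMeasurable ξ) (h0 : ∫ y, ξ y ∂μ = 0) (n : ℕ) :
    ∃ M : (Fin n → E) → ℝ, BddMeasurable M ∧ (∀ x, ∀ k ≤ n, |partialSum ξ x k| ≤ M x) ∧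
      ∫ x, (M x ^ 2 - 2 * (M x * |partialSum ξ x n|)) ∂(Measure.pi fun _ => μ) ≤ 0 := by
  induction n with
  | zero =>
    refine ⟨fun _ => 0, .const 0, fun x k _ => ?_, ?_⟩
    · simp [partialSum]
    · simp
  | succ n ih =>
    obtain ⟨M, hM, hMk, hMi⟩ := ih
    have hinit : Measurable fun z : Fin (n + 1) → E => (fun i : Fin n => z i.castSucc) :=
      measurable_pi_lambda _ fun i => measurable_pi_apply _
    have hS := bddMeasurable_partialSum (n := n + 1) hξ (n + 1)
    have hSn := bddMeasurable_partialSum (n := n) hξ n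
    have hM' : BddMeasurable fun z : Fin (n + 1) → E =>
        M (fun i : Fin n => z i.castSucc) ⊔ |partialSum ξ z (n + 1)| :=
      (hM.comp hinit).sup hS.abs
    have hsn : ∀ (x : Fin n → E) (y : E),
        (fun i : Fin n => (Fin.snoc x y : Fin (n + 1) → E) i.castSucc) = x := fun x y => by
      funext i; simp
    refine ⟨_, hM', fun z k hk => ?_, ?_⟩
    · rcases Nat.le_succ_iff.1 hk with hk | rfl
      · have : z = Fin.snoc (fun i : Fin n => z i.castSucc) (z (Fin.last n)) :=
          (Fin.snoc_init_self z).symm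
        refine le_trans (le_of_eq ?_) ((hMk (fun i : Fin n => z i.castSucc) k hk).trans le_sup_left)
        rw [this, partialSum_snoc_of_le ξ _ _ hk]
        simp
      · exact le_sup_right
    · have hI : BddMeasurable fun z : Fin (n + 1) → E =>
          (M (fun i : Fin n => z i.castSucc) ⊔ |partialSum ξ z (n + 1)|) ^ 2
            - 2 * ((M (fun i : Fin n => z i.castSucc) ⊔ |partialSum ξ z (n + 1)|)
              * |partialSum ξ z (n + 1)|) :=
        (hM'.pow 2).sub ((BddMeasurable.const 2).mul (hM'.mul hS.abs))
      rw [integral_pi_snoc μ hI]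
      refine le_trans (integral_mono
        (BddMeasurable.integral_right μ (hI.comp measurable_snoc) |>.integrable _)
        (((hM.pow 2).sub ((BddMeasurable.const 2).mul (hM.mul hSn.abs))).integrable _)
        fun x => ?_) hMi
      simp only [hsn, partialSum_snoc_succ]
      have hab : BddMeasurable fun y => |partialSum ξ x n + ξ y| :=
        ((BddMeasurable.const _).add hξ).abs
      have hM0 : 0 ≤ M x := (abs_nonneg _).trans (hMk x n le_rfl)
      have hJ : |partialSum ξ x n| ≤ ∫ y, |partialSum ξ x n + ξ y| ∂μ := by
        have h1 : ∫ y, (partialSum ξ x n + ξ y) ∂μ = partialSum ξ x n := by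
          rw [integral_add (integrable_const _) (hξ.integrable μ), h0]; simp
        conv_lhs => rw [← h1]
        exact abs_integral_le_integral_abs
      calc ∫ y, ((M x ⊔ |partialSum ξ x n + ξ y|) ^ 2
            - 2 * ((M x ⊔ |partialSum ξ x n + ξ y|) * |partialSum ξ x n + ξ y|)) ∂μ
          ≤ ∫ y, (M x ^ 2 - 2 * M x * |partialSum ξ x n + ξ y|) ∂μ := by
            refine integral_mono ?_ ?_ fun y => ?_
            · have hm := (BddMeasurable.const (M x)).sup hab
              exact ((hm.pow 2).sub ((BddMeasurable.const 2).mul (hm.mul hab))).integrable μ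
            · exact ((integrable_const _).sub ((hab.integrable μ).const_mul _))
            · rcases le_total (M x) |partialSum ξ x n + ξ y| with h | h
              · simp only [sup_eq_right.2 h]
                nlinarith [sq_nonneg (M x - |partialSum ξ x n + ξ y|)]
              · simp only [sup_eq_left.2 h]
                linarith
        _ = M x ^ 2 - 2 * M x * ∫ y, |partialSum ξ x n + ξ y| ∂μ := by
            rw [integral_sub (integrable_const _) ((hab.integrable μ).const_mul _),
              integral_const_mul]
            simp
        _ ≤ _ := by nlinarith [mul_le_mul_of_nonneg_left hJ hM0]

/-- Kolmogorov's maximal inequality, in `L¹` form. -/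
lemma exists_maximal_bound (μ : Measure E) [IsProbabilityMeasure μ] {ξ : E → ℝ}
    (hξ : BddMeasurable ξ) (h0 : ∫ y, ξ y ∂μ = 0) (n : ℕ) :
    ∃ M : (Fin n → E) → ℝ, BddMeasurable M ∧ (∀ x, ∀ k ≤ n, |partialSum ξ x k| ≤ M x) ∧
      ∫ x, M x ∂(Measure.pi fun _ => μ) ≤ 2 * √(n * ∫ y, ξ y ^ 2 ∂μ) := by
  obtain ⟨M, hM, hMk, hMi⟩ := exists_maximal_bound_aux μ hξ h0 n
  refine ⟨M, hM, hMk, ?_⟩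
  have hS := bddMeasurable_partialSum (n := n) hξ n
  set P : Measure (Fin n → E) := Measure.pi fun _ => μ
  have hM2 := (hM.pow 2).integrable P
  have hS2 := (hS.pow 2).integrable P
  have h1 : ∫ x, M x ^ 2 ∂P ≤ 4 * ∫ x, partialSum ξ x n ^ 2 ∂P := by
    -- The difference of the two integrands is `(M - 2 * |S|) ^ 2 / 2`, which yields Doob's constant
    -- `4`.
    have h2 : ∫ x, (M x ^ 2 / 2 - 2 * partialSum ξ x n ^ 2) ∂P ≤ 0 := by
      refine le_trans (integral_mono ((hM2.div_const 2).sub (hS2.const_mul 2))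
        (((hM.pow 2).sub ((BddMeasurable.const 2).mul (hM.mul hS.abs))).integrable P)
        fun x => ?_) hMi
      have := sq_abs (partialSum ξ x n)
      simp only
      nlinarith [sq_nonneg (M x - 2 * |partialSum ξ x n|)]
    rw [integral_sub (hM2.div_const 2) (hS2.const_mul 2), integral_div, integral_const_mul] at h2
    linarith
  rw [integral_partialSum_sq μ hξ h0] at h1
  have hM0 : ∀ x, 0 ≤ M x := fun x => (abs_nonneg _).trans (hMk x n le_rfl)
  have h3 := rpow_integral_le (μ := P) (r := 2) (by norm_num) hM hM0
  simp only [Real.rpow_two] at h3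
  have h4 : (∫ x, M x ∂P) ≤ √(4 * (n * ∫ y, ξ y ^ 2 ∂μ)) := Real.le_sqrt_of_sq_le (h3.trans h1)
  refine h4.trans (le_of_eq ?_)
  rw [Real.sqrt_mul (by norm_num), show (4 : ℝ) = 2 ^ 2 by norm_num, Real.sqrt_sq (by norm_num)]

end Maximal

/-! ### Moments of the maximal weighted deviation over finitely many sets -/

section EmpiricalProcess

variable {E : Type*} [MeasurableSpace E] {κ : Type*}

/-- The centred indicator of `A`. -/
noncomputable def centeredIndicator (μ : Measure E) (A : Set E) (x : E) : ℝ :=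
  A.indicator (fun _ => (1 : ℝ)) x - μ.real A

lemma bddMeasurable_centeredIndicator (μ : Measure E) {A : Set E} (hA : MeasurableSet A) :
    BddMeasurable (centeredIndicator μ A) :=
  (BddMeasurable.indicator_one hA).sub (.const _)

lemma integral_centeredIndicator (μ : Measure E) [IsProbabilityMeasure μ] {A : Set E}
    (hA : MeasurableSet A) : ∫ x, centeredIndicator μ A x ∂μ = 0 := by
  simp only [centeredIndicator]
  rw [integral_sub ((BddMeasurable.indicator_one hA).integrable μ) (integrable_const _),
    integral_indicator hA]
  simp

lemma integral_centeredIndicator_sq_le (μ : Measure E) [IsProbabilityMeasure μ] {A : Set E}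
    (hA : MeasurableSet A) : ∫ x, centeredIndicator μ A x ^ 2 ∂μ ≤ μ.real A := by
  have hi := (BddMeasurable.indicator_one hA).integrable μ
  have h : ∀ x, centeredIndicator μ A x ^ 2
      = (1 - 2 * μ.real A) * A.indicator (fun _ => (1 : ℝ)) x + μ.real A ^ 2 := by
    intro x
    by_cases hx : x ∈ A
    · simp [centeredIndicator, hx]; ring
    · simp [centeredIndicator, hx]
  simp_rw [h]
  rw [integral_add (hi.const_mul _) (integrable_const _), integral_const_mul, integral_indicator hA]
  simp
  nlinarith [sq_nonneg (μ.real A)]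

/-- The variance bound gives the square root. For rare sets, with `n * μ.real A ≤ 1`, the triangle
inequality does better. -/
lemma exists_maximal_bound_centeredIndicator (μ : Measure E) [IsProbabilityMeasure μ] {A : Set E}
    (hA : MeasurableSet A) (n : ℕ) :
    ∃ M : (Fin n → E) → ℝ, BddMeasurable M ∧
      (∀ x, ∀ k ≤ n, |partialSum (centeredIndicator μ A) x k| ≤ M x) ∧
      ∫ x, M x ∂(Measure.pi fun _ => μ) ≤ 2 * min (n * μ.real A) √(n * μ.real A) := by
  rcases le_total (n * μ.real A) √(n * μ.real A) with h | h
  · have hind := BddMeasurable.indicator_one hA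
    refine ⟨fun x => ∑ i, (A.indicator (fun _ => (1 : ℝ)) (x i) + μ.real A), ?_, ?_, ?_⟩
    · exact BddMeasurable.sum _ fun i _ =>
        (hind.comp (measurable_pi_apply i)).add (.const _)
    · intro x k _
      refine (Finset.abs_sum_le_sum_abs _ _).trans (Finset.sum_le_sum fun i _ => ?_)
      have h0 : 0 ≤ A.indicator (fun _ => (1 : ℝ)) (x i) :=
        Set.indicator_nonneg (fun _ _ => zero_le_one) _
      split_ifs
      · refine (abs_sub _ _).trans (le_of_eq ?_)
        rw [abs_of_nonneg h0, abs_of_nonneg measureReal_nonneg]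
      · rw [abs_zero]; exact add_nonneg h0 measureReal_nonneg
    · rw [min_eq_left h, integral_finsetSum]
      · refine le_of_eq ?_
        have hev : ∀ i : Fin n, ∫ x : Fin n → E, (A.indicator (fun _ => (1 : ℝ)) (x i) + μ.real A)
            ∂(Measure.pi fun _ => μ) = 2 * μ.real A := by
          intro i
          have hmp := measurePreserving_eval (fun _ : Fin n => μ) i
          rw [integral_add ((hind.comp (measurable_pi_apply i)).integrable _) (integrable_const _)]
          have := integral_map (μ := Measure.pi fun _ : Fin n => μ)
            (measurable_pi_apply i).aemeasurable (f := A.indicator fun _ => (1 : ℝ))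
            hind.1.aestronglyMeasurable
          rw [← this, show (fun x : Fin n → E => x i) = Function.eval i from rfl, hmp.map_eq,
            integral_indicator hA]
          simp
          ring
        simp_rw [hev]
        simp
        ring
      · exact fun i _ => ((hind.comp (measurable_pi_apply i)).add (.const _)).integrable _
  · obtain ⟨M, hM, hMk, hMi⟩ := exists_maximal_bound μ (bddMeasurable_centeredIndicator μ hA)
      (integral_centeredIndicator μ hA) n
    refine ⟨M, hM, hMk, hMi.trans ?_⟩
    rw [min_eq_right h]
    gcongr
    exact integral_centeredIndicator_sq_le μ hA

/-- The maximum over `k ≤ n` of the weighted sum of the deviations of `k` times the empirical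
measure of the first `k` points from its mean, on finitely many sets. -/
noncomputable def maxDeviation (μ : Measure E) (A : κ → Set E) (w : κ → ℝ) (T : Finset κ) {n : ℕ}
    (x : Fin n → E) : ℝ :=
  (Finset.range (n + 1)).sup' Finset.nonempty_range_add_one fun k =>
    ∑ t ∈ T, w t * |partialSum (centeredIndicator μ (A t)) x k|

variable {A : κ → Set E} {w : κ → ℝ}

lemma le_maxDeviation (μ : Measure E) (A : κ → Set E) (w : κ → ℝ) (T : Finset κ) {n : ℕ}
    (x : Fin n → E) {k : ℕ} (hk : k ≤ n) :
    ∑ t ∈ T, w t * |partialSum (centeredIndicator μ (A t)) x k| ≤ maxDeviation μ A w T x :=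
  Finset.le_sup' (fun k => ∑ t ∈ T, w t * |partialSum (centeredIndicator μ (A t)) x k|)
    (Finset.mem_range.2 (Nat.lt_succ_of_le hk))

lemma bddMeasurable_maxDeviation (μ : Measure E) (hA : ∀ t, MeasurableSet (A t)) (T : Finset κ)
    {n : ℕ} : BddMeasurable fun x : Fin n → E => maxDeviation μ A w T x := by
  have h : ∀ (s : Finset ℕ) (hs : s.Nonempty), BddMeasurable fun x : Fin n → E =>
      s.sup' hs fun k => ∑ t ∈ T, w t * |partialSum (centeredIndicator μ (A t)) x k| := by
    intro s hs
    have hb : ∀ k, BddMeasurable fun x : Fin n → E =>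
        ∑ t ∈ T, w t * |partialSum (centeredIndicator μ (A t)) x k| := fun k =>
      BddMeasurable.sum _ fun t _ => (BddMeasurable.const _).mul
        (bddMeasurable_partialSum (bddMeasurable_centeredIndicator μ (hA t)) k).abs
    induction hs using Finset.Nonempty.cons_induction with
    | singleton a => simpa using hb a
    | cons a s ha hs ih =>
      simp only [Finset.sup'_cons hs]
      exact (hb a).sup ih
  exact h _ _

lemma maxDeviation_nonneg (μ : Measure E) (T : Finset κ) {n : ℕ} (x : Fin n → E)
    (hw : ∀ t, 0 ≤ w t) : 0 ≤ maxDeviation μ A w T x :=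
  (Finset.sum_nonneg fun t _ => mul_nonneg (hw t) (abs_nonneg _)).trans
    (le_maxDeviation μ A w T x (Nat.zero_le n))

/-- Changing one point changes every partial sum by at most one increment, uniformly in `k`, so the
bound passes to the maximum. The pair `z`, `z'` is left free so that both directions of the
replacement are covered. -/
lemma maxDeviation_le_add (μ : Measure E) (hw : ∀ t, 0 ≤ w t) (T : Finset κ) {n : ℕ}
    (x : Fin n → E) (i : Fin n) (y : E) {z z' : Fin n → E}
    (hz : ∀ (ξ : E → ℝ) k, |partialSum ξ z k - partialSum ξ z' k| ≤ |ξ (x i) - ξ y|) :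
    maxDeviation μ A w T z ≤ maxDeviation μ A w T z'
      + (∑ t ∈ T, w t * (A t).indicator (fun _ => (1 : ℝ)) (x i)
        + ∑ t ∈ T, w t * (A t).indicator (fun _ => (1 : ℝ)) y) := by
  refine Finset.sup'_le _ _ fun k hk => ?_
  refine le_trans ?_ (add_le_add_left
    (le_maxDeviation μ A w T z' (Nat.le_of_lt_succ (Finset.mem_range.1 hk))) _)
  rw [← Finset.sum_add_distrib, ← Finset.sum_add_distrib]
  refine Finset.sum_le_sum fun t _ => ?_
  rw [← mul_add, ← mul_add]
  refine mul_le_mul_of_nonneg_left ?_ (hw t)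
  have h1 := hz (centeredIndicator μ (A t)) k
  have h2 : |centeredIndicator μ (A t) (x i) - centeredIndicator μ (A t) y|
      ≤ (A t).indicator (fun _ => (1 : ℝ)) (x i) + (A t).indicator (fun _ => (1 : ℝ)) y := by
    have h0 : ∀ z, 0 ≤ (A t).indicator (fun _ => (1 : ℝ)) z :=
      fun z => Set.indicator_nonneg (fun _ _ => zero_le_one) _
    rw [centeredIndicator, centeredIndicator, sub_sub_sub_cancel_right]
    refine (abs_sub _ _).trans (le_of_eq ?_)
    rw [abs_of_nonneg (h0 _), abs_of_nonneg (h0 _)]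
  have h3 := abs_sub_abs_le_abs_sub (partialSum (centeredIndicator μ (A t)) z k)
    (partialSum (centeredIndicator μ (A t)) z' k)
  linarith

lemma integral_maxDeviation_le (μ : Measure E) [IsProbabilityMeasure μ]
    (hA : ∀ t, MeasurableSet (A t)) (hw : ∀ t, 0 ≤ w t) (T : Finset κ) (n : ℕ) :
    ∫ x : Fin n → E, maxDeviation μ A w T x ∂(Measure.pi fun _ => μ)
      ≤ ∑ t ∈ T, w t * (2 * min (n * μ.real (A t)) √(n * μ.real (A t))) := by
  choose M hM hMk hMi using fun t => exists_maximal_bound_centeredIndicator μ (hA t) n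
  calc ∫ x : Fin n → E, maxDeviation μ A w T x ∂(Measure.pi fun _ => μ)
      ≤ ∫ x : Fin n → E, ∑ t ∈ T, w t * M t x ∂(Measure.pi fun _ => μ) := by
        refine integral_mono ((bddMeasurable_maxDeviation μ hA T).integrable _)
          ((BddMeasurable.sum _ fun t _ => (BddMeasurable.const _).mul (hM t)).integrable _)
          fun x => ?_
        refine Finset.sup'_le _ _ fun k hk => Finset.sum_le_sum fun t _ => ?_
        exact mul_le_mul_of_nonneg_left
          (hMk t x k (Nat.le_of_lt_succ (Finset.mem_range.1 hk))) (hw t)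
    _ = ∑ t ∈ T, w t * ∫ x, M t x ∂(Measure.pi fun _ => μ) := by
        rw [integral_finsetSum _ fun t _ => ((hM t).integrable _).const_mul _]
        simp_rw [integral_const_mul]
    _ ≤ _ := Finset.sum_le_sum fun t _ => mul_le_mul_of_nonneg_left (hMi t) (hw t)

/-- The moment is split into the fluctuation about the mean, bounded through the bounded
differences, and the mean itself. -/
lemma integral_maxDeviation_rpow_le (μ : Measure E) [IsProbabilityMeasure μ]
    (hA : ∀ t, MeasurableSet (A t)) (hw : ∀ t, 0 ≤ w t) (T : Finset κ) (n : ℕ) {r : ℝ}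
    (hr₁ : 1 < r) (hr₂ : r < 2) :
    ∫ x : Fin n → E, maxDeviation μ A w T x ^ r ∂(Measure.pi fun _ => μ)
      ≤ 2 * (16 * n * ∫ y, (∑ t ∈ T, w t * (A t).indicator (fun _ => (1 : ℝ)) y) ^ r ∂μ
        + (∑ t ∈ T, w t * (2 * min (n * μ.real (A t)) √(n * μ.real (A t)))) ^ r) := by
  have hF := bddMeasurable_maxDeviation (w := w) μ hA T (n := n)
  have hF0 := fun x : Fin n → E => maxDeviation_nonneg (A := A) μ T x hw
  set e := ∫ x : Fin n → E, maxDeviation μ A w T x ∂(Measure.pi fun _ => μ) with he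
  have he0 : 0 ≤ e := integral_nonneg hF0
  have hg : BddMeasurable fun y => ∑ t ∈ T, w t * (A t).indicator (fun _ => (1 : ℝ)) y :=
    BddMeasurable.sum _ fun t _ => (BddMeasurable.const _).mul (.indicator_one (hA t))
  have hg0 : ∀ y, 0 ≤ ∑ t ∈ T, w t * (A t).indicator (fun _ => (1 : ℝ)) y := fun y =>
    Finset.sum_nonneg fun t _ => mul_nonneg (hw t) (Set.indicator_nonneg (fun _ _ => zero_le_one) _)
  have hdA := integral_abs_sub_integral_rpow_le μ hr₁ hr₂ hg hg0 hF (fun x i y => by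
    rw [abs_sub_le_iff]
    constructor
    · have := maxDeviation_le_add (A := A) μ hw T x i y (z := x) (z' := Function.update x i y)
        fun ξ k => abs_partialSum_sub_update_le ξ x i y k
      linarith
    · have := maxDeviation_le_add (A := A) μ hw T x i y (z := Function.update x i y) (z' := x)
        fun ξ k => by rw [abs_sub_comm]; exact abs_partialSum_sub_update_le ξ x i y k
      linarith)
  rw [← he] at hdA
  have hFe : BddMeasurable fun x : Fin n → E => |maxDeviation μ A w T x - e| ^ r :=
    (hF.sub (.const e)).rpow (by linarith)
  have hFr : BddMeasurable fun x : Fin n → E => maxDeviation μ A w T x ^ r := by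
    simpa only [abs_of_nonneg (hF0 _)] using hF.rpow (r := r) (by linarith)
  calc ∫ x : Fin n → E, maxDeviation μ A w T x ^ r ∂(Measure.pi fun _ => μ)
      ≤ ∫ x : Fin n → E, 2 * (|maxDeviation μ A w T x - e| ^ r + e ^ r)
          ∂(Measure.pi fun _ => μ) := by
        refine integral_mono (hFr.integrable _)
          (((BddMeasurable.const 2).mul (hFe.add (.const _))).integrable _) fun x => ?_
        refine le_trans ?_ (add_rpow_le_two_mul hr₁ hr₂ (abs_nonneg _) he0)
        refine Real.rpow_le_rpow (hF0 x) ?_ (by linarith)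
        have := le_abs_self (maxDeviation μ A w T x - e)
        linarith
    _ = 2 * (∫ x : Fin n → E, |maxDeviation μ A w T x - e| ^ r ∂(Measure.pi fun _ => μ)
          + e ^ r) := by
        rw [integral_const_mul, integral_add (hFe.integrable _) (integrable_const _)]
        simp
    _ ≤ _ := by
        have := Real.rpow_le_rpow he0 (integral_maxDeviation_le μ hA hw T n)
          (by linarith : 0 ≤ r)
        linarith

end EmpiricalProcess

/-! ### Passage to countably many sets and to empirical measures -/

section EmpiricalProcessENNReal

variable {E : Type*} [MeasurableSpace E] {κ : Type*} {A : κ → Set E}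

lemma maxDeviation_mono (μ : Measure E) (w : κ → ℝ≥0) {n : ℕ} (x : Fin n → E) :
    Monotone fun T => maxDeviation μ A (fun t => (w t : ℝ)) T x := by
  intro T T' h
  refine Finset.sup'_le _ _ fun k hk => ?_
  refine le_trans ?_ (le_maxDeviation μ A _ T' x (Nat.le_of_lt_succ (Finset.mem_range.1 hk)))
  exact Finset.sum_le_sum_of_subset_of_nonneg h fun t _ _ =>
    mul_nonneg (w t).2 (abs_nonneg _)

/-- The finite bounds do not depend on the size of `T`, so monotone convergence along the directed
family of finite sets applies. -/
lemma lintegral_iSup_maxDeviation_rpow_le [Countable κ] (μ : Measure E) [IsProbabilityMeasure μ]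
    (hA : ∀ t, MeasurableSet (A t)) (w : κ → ℝ≥0) (n : ℕ) {r : ℝ} (hr₁ : 1 < r) (hr₂ : r < 2) :
    ∫⁻ x : Fin n → E, (⨆ T : Finset κ,
        ENNReal.ofReal (maxDeviation μ A (fun t => (w t : ℝ)) T x)) ^ r ∂(Measure.pi fun _ => μ)
      ≤ 32 * n * ∫⁻ y, (∑' t, (w t : ℝ≥0∞) * (A t).indicator 1 y) ^ r ∂μ
        + 2 * (∑' t, (w t : ℝ≥0∞) * (2 * ENNReal.ofReal
            (min (n * μ.real (A t)) √(n * μ.real (A t))))) ^ r := by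
  have hr0 : 0 < r := by linarith
  have hw : ∀ t, 0 ≤ (w t : ℝ) := fun t => (w t).2
  have hF0 := fun (T : Finset κ) (x : Fin n → E) => maxDeviation_nonneg (A := A) μ T x hw
  have hFm := fun T : Finset κ => (bddMeasurable_maxDeviation (w := fun t => (w t : ℝ)) μ hA T
    (n := n))
  have hsup : ∀ x : Fin n → E, (⨆ T : Finset κ,
        ENNReal.ofReal (maxDeviation μ A (fun t => (w t : ℝ)) T x)) ^ r
      = ⨆ T : Finset κ, ENNReal.ofReal (maxDeviation μ A (fun t => (w t : ℝ)) T x ^ r) := by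
    intro x
    rw [← ENNReal.orderIsoRpow_apply r hr0, OrderIso.map_iSup]
    simp_rw [ENNReal.orderIsoRpow_apply, ENNReal.ofReal_rpow_of_nonneg (hF0 _ x) hr0.le]
  simp_rw [hsup]
  rw [lintegral_iSup_directed_of_measurable]
  · refine iSup_le fun T => ?_
    have hFr : BddMeasurable fun x : Fin n → E =>
        maxDeviation μ A (fun t => (w t : ℝ)) T x ^ r := by
      simpa only [abs_of_nonneg (hF0 T _)] using (hFm T).rpow hr0.le
    rw [← ofReal_integral_eq_lintegral_ofReal (hFr.integrable _)
      (Eventually.of_forall fun x => Real.rpow_nonneg (hF0 T x) r)]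
    refine (ENNReal.ofReal_le_ofReal
      (integral_maxDeviation_rpow_le μ hA hw T n hr₁ hr₂)).trans ?_
    have hg : BddMeasurable fun y => ∑ t ∈ T, (w t : ℝ) * (A t).indicator (fun _ => (1 : ℝ)) y :=
      BddMeasurable.sum _ fun t _ => (BddMeasurable.const _).mul (.indicator_one (hA t))
    have hg0 : ∀ y, 0 ≤ ∑ t ∈ T, (w t : ℝ) * (A t).indicator (fun _ => (1 : ℝ)) y := fun y =>
      Finset.sum_nonneg fun t _ =>
        mul_nonneg (hw t) (Set.indicator_nonneg (fun _ _ => zero_le_one) _)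
    have hgr : BddMeasurable fun y =>
        (∑ t ∈ T, (w t : ℝ) * (A t).indicator (fun _ => (1 : ℝ)) y) ^ r := by
      simpa only [abs_of_nonneg (hg0 _)] using hg.rpow hr0.le
    have hB0 : 0 ≤ ∑ t ∈ T, (w t : ℝ) * (2 * min (n * μ.real (A t)) √(n * μ.real (A t))) :=
      Finset.sum_nonneg fun t _ => mul_nonneg (hw t) (by positivity)
    rw [mul_add, ENNReal.ofReal_add (mul_nonneg zero_le_two (mul_nonneg (by positivity)
      (integral_nonneg fun y => Real.rpow_nonneg (hg0 y) r)))
      (mul_nonneg zero_le_two (Real.rpow_nonneg hB0 r))]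
    refine add_le_add ?_ ?_
    · rw [← mul_assoc, ENNReal.ofReal_mul (by positivity), ofReal_integral_eq_lintegral_ofReal
        (hgr.integrable μ) (Eventually.of_forall fun x => Real.rpow_nonneg (hg0 x) r)]
      refine mul_le_mul' (le_of_eq ?_) (lintegral_mono fun y => ?_)
      · rw [← mul_assoc, ENNReal.ofReal_mul (by norm_num), ENNReal.ofReal_natCast]
        norm_num
      · rw [← ENNReal.ofReal_rpow_of_nonneg (hg0 y) hr0.le]
        refine ENNReal.rpow_le_rpow ?_ hr0.le
        rw [ENNReal.ofReal_sum_of_nonneg fun t _ =>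
          mul_nonneg (hw t) (Set.indicator_nonneg (fun _ _ => zero_le_one) _)]
        refine le_trans (Finset.sum_le_sum fun t _ => ?_) (ENNReal.sum_le_tsum T)
        rw [ENNReal.ofReal_mul (hw t), ENNReal.ofReal_coe_nnreal]
        gcongr
        by_cases hy : y ∈ A t <;> simp [hy]
    · rw [ENNReal.ofReal_mul zero_le_two, ← ENNReal.ofReal_rpow_of_nonneg hB0 hr0.le]
      refine mul_le_mul' (by norm_num) (ENNReal.rpow_le_rpow ?_ hr0.le)
      rw [ENNReal.ofReal_sum_of_nonneg fun t _ => mul_nonneg (hw t) (by positivity)]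
      refine le_trans (Finset.sum_le_sum fun t _ => ?_) (ENNReal.sum_le_tsum T)
      rw [ENNReal.ofReal_mul (hw t), ENNReal.ofReal_coe_nnreal, ENNReal.ofReal_mul zero_le_two]
      gcongr
      norm_num
  · intro T
    exact ((hFm T).1.pow_const r).ennreal_ofReal
  · refine Monotone.directed_le fun T T' h x => ENNReal.ofReal_le_ofReal ?_
    exact Real.rpow_le_rpow (hF0 T x) (maxDeviation_mono μ w x h) hr0.le

lemma ofReal_abs_sub_eq_tsub_add_tsub {a b : ℝ≥0∞} (ha : a ≠ ∞) (hb : b ≠ ∞) :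
    ENNReal.ofReal |a.toReal - b.toReal| = (a - b) + (b - a) := by
  rcases le_total a b with h | h
  · rw [tsub_eq_zero_of_le h, zero_add, abs_sub_comm,
      abs_of_nonneg (sub_nonneg.2 (ENNReal.toReal_mono hb h)), ← ENNReal.toReal_sub_of_le h hb,
      ENNReal.ofReal_toReal (ENNReal.sub_ne_top hb)]
  · rw [tsub_eq_zero_of_le h, add_zero,
      abs_of_nonneg (sub_nonneg.2 (ENNReal.toReal_mono ha h)), ← ENNReal.toReal_sub_of_le h ha,
      ENNReal.ofReal_toReal (ENNReal.sub_ne_top ha)]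

lemma partialSum_centeredIndicator {d n : ℕ} (μ : Measure (EuclideanSpace ℝ (Fin d)))
    {A : Set (EuclideanSpace ℝ (Fin d))} (hA : MeasurableSet A)
    (x : Fin n → EuclideanSpace ℝ (Fin d)) {k : ℕ} (hk₁ : 1 ≤ k) (hk : k ≤ n) :
    partialSum (centeredIndicator μ A) x k
      = k * ((empiricalMeasure fun i : Fin k => x (Fin.castLE hk i)).real A - μ.real A) := by
  have h1 : partialSum (centeredIndicator μ A) x k
      = ∑ i : Fin k, centeredIndicator μ A (x (Fin.castLE hk i)) := by
    rw [partialSum, ← Finset.sum_filter]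
    refine (Finset.sum_bij (fun i _ => Fin.castLE hk i) ?_ ?_ ?_ ?_).symm
    · intro i _; simp
    · intro i _ j _ h; simpa [Fin.ext_iff] using h
    · intro b hb
      exact ⟨⟨b, (Finset.mem_filter.1 hb).2⟩, Finset.mem_univ _, by simp⟩
    · intro i _; rfl
  have h2 : (empiricalMeasure fun i : Fin k => x (Fin.castLE hk i)).real A
      = (k : ℝ)⁻¹ * ∑ i : Fin k, A.indicator (fun _ => (1 : ℝ)) (x (Fin.castLE hk i)) := by
    rw [empiricalMeasure, measureReal_ennreal_smul_apply, ENNReal.toReal_inv,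
      ENNReal.toReal_natCast, Measure.real, Measure.finsetSum_apply, ENNReal.toReal_sum]
    · congr 1
      refine Finset.sum_congr rfl fun i _ => ?_
      rw [Measure.dirac_apply' _ hA]
      by_cases hx : x (Fin.castLE hk i) ∈ A <;> simp [hx]
    · intro i _; exact measure_ne_top _ _
  have hk0 : (k : ℝ) ≠ 0 := by positivity
  rw [h1, h2, mul_sub, ← mul_assoc, mul_inv_cancel₀ hk0, one_mul]
  simp [centeredIndicator, Finset.sum_sub_distrib]

lemma mul_tsum_deviation_le {d n : ℕ} (μ : Measure (EuclideanSpace ℝ (Fin d)))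
    [IsProbabilityMeasure μ] {A : κ → Set (EuclideanSpace ℝ (Fin d))}
    (hA : ∀ t, MeasurableSet (A t)) (w : κ → ℝ≥0)
    (x : Fin n → EuclideanSpace ℝ (Fin d)) {k : ℕ} (hk₁ : 1 ≤ k) (hk : k ≤ n)
    {ν : Measure (EuclideanSpace ℝ (Fin d))}
    (hν : ν = empiricalMeasure fun i : Fin k => x (Fin.castLE hk i)) :
    (k : ℝ≥0∞) * ∑' t, (w t : ℝ≥0∞) * ((ν (A t) - μ (A t)) + (μ (A t) - ν (A t)))
      ≤ ⨆ T : Finset κ, ENNReal.ofReal (maxDeviation μ A (fun t => (w t : ℝ)) T x) := by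
  have : IsProbabilityMeasure ν := hν ▸ isProbabilityMeasure_empiricalMeasure hk₁ _
  rw [← ENNReal.tsum_mul_left, ENNReal.tsum_eq_iSup_sum]
  refine iSup_mono fun T => ?_
  refine le_trans (le_of_eq ?_) (ENNReal.ofReal_le_ofReal (le_maxDeviation μ A _ T x hk))
  rw [ENNReal.ofReal_sum_of_nonneg fun t _ => mul_nonneg (w t).coe_nonneg (abs_nonneg _)]
  refine Finset.sum_congr rfl fun t _ => ?_
  rw [ENNReal.ofReal_mul (w t).coe_nonneg, ENNReal.ofReal_coe_nnreal,
    partialSum_centeredIndicator μ (hA t) x hk₁ hk, ← hν, abs_mul, Nat.abs_cast,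
    ENNReal.ofReal_mul (Nat.cast_nonneg k), ENNReal.ofReal_natCast, Measure.real, Measure.real,
    ofReal_abs_sub_eq_tsub_add_tsub (measure_ne_top _ _) (measure_ne_top _ _), mul_left_comm]

end EmpiricalProcessENNReal

/-! ### Geometric series with a peak -/

section Series

lemma exists_first_pow_ge {b : ℝ} (hb : 1 < b) (N : ℝ) :
    ∃ i₀ : ℕ, N ≤ b ^ i₀ ∧ ∀ i < i₀, b ^ i < N := by
  classical
  have hex : ∃ i : ℕ, N ≤ b ^ i := (pow_unbounded_of_one_lt N hb).imp fun _ h => h.le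
  exact ⟨Nat.find hex, Nat.find_spec hex, fun i hi => not_le.1 (Nat.find_min hex hi)⟩

/-- The terms decay geometrically on both sides of the index where `b ^ i` passes `N`, so the bound
does not depend on `N`. -/
lemma tsum_min_geometric_le {b : ℝ} (hb : 1 < b) {N : ℝ} (hN : 1 ≤ N) :
    ∑' i : ℕ, ENNReal.ofReal (min (b ^ i / N) (N / b ^ i))
      ≤ 2 * (1 - ENNReal.ofReal b⁻¹)⁻¹ := by
  have hb0 : 0 < b := by linarith
  have hN0 : 0 < N := by linarith
  obtain ⟨i₀, h1, h2⟩ := exists_first_pow_ge hb N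
  set f : ℕ → ℝ≥0∞ := fun i => ENNReal.ofReal (min (b ^ i / N) (N / b ^ i)) with hf
  have hgeo : (1 - ENNReal.ofReal b⁻¹)⁻¹ = ∑' i : ℕ, ENNReal.ofReal b⁻¹ ^ i :=
    (ENNReal.tsum_geometric _).symm
  have hsplit : ∑' i, f i = ∑ i ∈ Finset.range i₀, f i + ∑' i, f (i + i₀) :=
    (ENNReal.summable.sum_add_tsum_nat_add' (k := i₀)).symm
  rw [hsplit, two_mul, hgeo]
  refine add_le_add ?_ (ENNReal.tsum_le_tsum fun i => ?_)
  · rw [← Finset.sum_range_reflect]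
    refine le_trans (Finset.sum_le_sum fun i hi => ?_) (ENNReal.sum_le_tsum (Finset.range i₀))
    have hi' := Finset.mem_range.1 hi
    rw [← ENNReal.ofReal_pow (by positivity)]
    refine ENNReal.ofReal_le_ofReal ((min_le_left _ _).trans ?_)
    rw [div_le_iff₀ hN0, inv_pow]
    have h3 := h2 (i₀ - 1) (by omega)
    have h4 : b ^ (i₀ - 1) = b ^ (i₀ - 1 - i) * b ^ i := by
      rw [← pow_add]; congr 1; omega
    rw [h4] at h3
    rw [inv_mul_eq_div, le_div_iff₀ (by positivity)]
    exact h3.le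
  · rw [← ENNReal.ofReal_pow (by positivity)]
    refine ENNReal.ofReal_le_ofReal ((min_le_right _ _).trans ?_)
    rw [pow_add, inv_pow, div_le_iff₀ (by positivity), ← mul_assoc,
      inv_mul_cancel₀ (by positivity), one_mul]
    exact h1

/-- A double series whose terms are dominated by a whole family of geometric terms. -/
lemma exists_tsum_tsum_le {b₁ b₂ v₁ v₂ : ℝ} (hb₁ : 1 < b₁) (hb₂ : 1 < b₂) (hv : v₁ < v₂)
    (hv0 : 0 < v₁) (hv1 : v₁ < 1 / 2) : ∃ C : ℝ≥0, ∀ (n : ℕ) (c : ℝ≥0∞) (a : ℕ → ℕ → ℝ≥0∞),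
      1 ≤ n → (∀ i j v, 0 ≤ v → v ≤ 1 / 2 → a i j ≤ c * ENNReal.ofReal ((n : ℝ) ^ (-v)
        * b₁ ^ ((i : ℝ) * (v - v₁)) * b₂ ^ ((j : ℝ) * (v - v₂)))) →
      ∑' i, ∑' j, a i j ≤ c * (C * ENNReal.ofReal ((n : ℝ) ^ (-v₁))) := by
  -- The first two upper bounds keep `v₁ ± ε` in `[0, 1 / 2]`; the last keeps both at distance at
  -- least `(v₂ - v₁) / 2` below `v₂`, so the sum over `j` is geometric with ratio `ρ`.
  obtain ⟨ε, hε0, hε1, hε2, hε3⟩ : ∃ ε : ℝ, 0 < ε ∧ ε ≤ v₁ ∧ ε ≤ 1 / 2 - v₁ ∧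
      ε ≤ (v₂ - v₁) / 2 := by
    refine ⟨min v₁ (min (1 / 2 - v₁) ((v₂ - v₁) / 2)), ?_, min_le_left _ _,
      (min_le_right _ _).trans (min_le_left _ _), (min_le_right _ _).trans (min_le_right _ _)⟩
    exact lt_min hv0 (lt_min (by linarith) (by linarith))
  set ρ : ℝ := b₂ ^ (-((v₂ - v₁) / 2)) with hρ
  set b : ℝ := b₁ ^ ε with hb
  have hb1 : 1 < b := Real.one_lt_rpow hb₁ hε0
  have hρ0 : 0 < ρ := Real.rpow_pos_of_pos (by linarith) _
  have hρ1 : ρ < 1 := Real.rpow_lt_one_of_one_lt_of_neg hb₂ (by linarith)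
  have hfin : ∀ t : ℝ, t < 1 → (1 - ENNReal.ofReal t)⁻¹ ≠ ∞ := by
    intro t ht
    rw [ENNReal.inv_ne_top, ← pos_iff_ne_zero, tsub_pos_iff_lt]
    exact ENNReal.ofReal_lt_one.2 ht
  have hbinv : b⁻¹ < 1 := inv_lt_one_of_one_lt₀ hb1
  set D := 2 * (1 - ENNReal.ofReal b⁻¹)⁻¹ * (1 - ENNReal.ofReal ρ)⁻¹ with hD
  have hDt : D ≠ ∞ := ENNReal.mul_ne_top (ENNReal.mul_ne_top (by simp) (hfin _ hbinv)) (hfin _ hρ1)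
  refine ⟨D.toNNReal, fun n c a hn ha => ?_⟩
  rw [ENNReal.coe_toNNReal hDt]
  have hn0 : (0 : ℝ) < n := by exact_mod_cast hn
  set N : ℝ := (n : ℝ) ^ ε with hN
  have hN1 : 1 ≤ N := Real.one_le_rpow (by exact_mod_cast hn) hε0.le
  have hb1n : ∀ i : ℕ, b ^ i = b₁ ^ ((i : ℝ) * ε) := fun i => by
    rw [hb, mul_comm, Real.rpow_mul (by linarith), Real.rpow_natCast]
  have hbound : ∀ (i j : ℕ) (v : ℝ), v - v₂ ≤ -((v₂ - v₁) / 2) →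
      b₂ ^ ((j : ℝ) * (v - v₂)) ≤ ρ ^ j := by
    intro i j v hvv
    rw [hρ, ← Real.rpow_natCast, ← Real.rpow_mul (by linarith), mul_comm]
    exact Real.rpow_le_rpow_of_exponent_le hb₂.le
      (mul_le_mul_of_nonneg_right hvv (Nat.cast_nonneg j))
  have hterm : ∀ i j, a i j ≤ c * (ENNReal.ofReal ((n : ℝ) ^ (-v₁)) *
      (ENNReal.ofReal (min (b ^ i / N) (N / b ^ i)) * ENNReal.ofReal ρ ^ j)) := by
    intro i j
    rw [← ENNReal.ofReal_pow hρ0.le, ← ENNReal.ofReal_mul (by positivity),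
      ← ENNReal.ofReal_mul (by positivity)]
    -- The choices `v₁ + ε` and `v₁ - ε` give growth and decay in `i`; their minimum peaks where `b
    -- ^ i` is close to `N = n ^ ε`.
    have key : a i j ≤ c * ENNReal.ofReal ((n : ℝ) ^ (-v₁) * ((b ^ i / N) * ρ ^ j)) ∧
        a i j ≤ c * ENNReal.ofReal ((n : ℝ) ^ (-v₁) * ((N / b ^ i) * ρ ^ j)) := by
      constructor
      · refine (ha i j (v₁ + ε) (by linarith) (by linarith))
          |>.trans (mul_le_mul' le_rfl (ENNReal.ofReal_le_ofReal ?_))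
        have e1 : (n : ℝ) ^ (-(v₁ + ε)) = (n : ℝ) ^ (-v₁) / N := by
          rw [hN, ← Real.rpow_sub hn0]; congr 1; ring
        have e2 : b₁ ^ ((i : ℝ) * (v₁ + ε - v₁)) = b ^ i := by
          rw [hb1n]; congr 1; ring
        rw [e1, e2]
        calc (n : ℝ) ^ (-v₁) / N * b ^ i * b₂ ^ ((j : ℝ) * (v₁ + ε - v₂))
            ≤ (n : ℝ) ^ (-v₁) / N * b ^ i * ρ ^ j := by
              gcongr; exact hbound i j _ (by linarith)
          _ = _ := by ring
      · refine (ha i j (v₁ - ε) (by linarith) (by linarith))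
          |>.trans (mul_le_mul' le_rfl (ENNReal.ofReal_le_ofReal ?_))
        have e1 : (n : ℝ) ^ (-(v₁ - ε)) = (n : ℝ) ^ (-v₁) * N := by
          rw [hN, ← Real.rpow_add hn0]; congr 1; ring
        have e2 : b₁ ^ ((i : ℝ) * (v₁ - ε - v₁)) = (b ^ i)⁻¹ := by
          rw [hb1n, ← Real.rpow_neg (by linarith)]; congr 1; ring
        rw [e1, e2]
        calc (n : ℝ) ^ (-v₁) * N * (b ^ i)⁻¹ * b₂ ^ ((j : ℝ) * (v₁ - ε - v₂))
            ≤ (n : ℝ) ^ (-v₁) * N * (b ^ i)⁻¹ * ρ ^ j := by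
              gcongr; exact hbound i j _ (by linarith)
          _ = _ := by ring
    rcases min_choice (b ^ i / N) (N / b ^ i) with h | h
    · rw [h]; exact key.1
    · rw [h]; exact key.2
  calc ∑' i, ∑' j, a i j
      ≤ ∑' i, ∑' j, c * (ENNReal.ofReal ((n : ℝ) ^ (-v₁)) *
      (ENNReal.ofReal (min (b ^ i / N) (N / b ^ i)) * ENNReal.ofReal ρ ^ j)) :=
        ENNReal.tsum_le_tsum fun i => ENNReal.tsum_le_tsum fun j => hterm i j
    _ = c * (ENNReal.ofReal ((n : ℝ) ^ (-v₁)) *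
          ((∑' i, ENNReal.ofReal (min (b ^ i / N) (N / b ^ i))) * (1 - ENNReal.ofReal ρ)⁻¹)) := by
        simp_rw [ENNReal.tsum_mul_left, ENNReal.tsum_geometric, ENNReal.tsum_mul_right]
    _ ≤ c * (ENNReal.ofReal ((n : ℝ) ^ (-v₁)) * D) := by
        rw [hD]
        gcongr
        exact tsum_min_geometric_le hb1 hN1
    _ = _ := by rw [mul_comm D]

end Series

/-! ### Dyadic cells in dyadic shells -/

section Cells

variable {d : ℕ} {R : ℝ≥0}

/-- The index `m` of the dyadic shell of outer radius `R * 2 ^ m`, for the maximum norm, that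
contains `x`. -/
noncomputable def shell (R : ℝ≥0) (x : EuclideanSpace ℝ (Fin d)) : ℕ :=
  ⌈Real.logb 2 (‖WithLp.ofLp x‖ / R)⌉₊

/-- The cell of `x` at level `l`: its shell, together with its dyadic cube of side
`R * 2 ^ m / 2 ^ l`. -/
noncomputable def cell (R : ℝ≥0) (l : ℕ) (x : EuclideanSpace ℝ (Fin d)) : ℕ × (Fin d → ℤ) :=
  (shell R x, fun i => ⌊2 ^ l * (x i / (R * 2 ^ shell R x))⌋)

lemma measurable_shell : Measurable (shell R : EuclideanSpace ℝ (Fin d) → ℕ) := by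
  refine Nat.measurable_ceil.comp ?_
  refine (Real.measurable_log.comp (Measurable.div_const ?_ _)).div_const _
  exact measurable_norm.comp (WithLp.measurable_ofLp 2 (Fin d → ℝ))

lemma measurable_cell (l : ℕ) : Measurable (cell R l : EuclideanSpace ℝ (Fin d) → _) := by
  refine measurable_shell.prodMk (measurable_pi_lambda _ fun i => ?_)
  refine Int.measurable_floor.comp (Measurable.const_mul (Measurable.div ?_ ?_) _)
  · exact (measurable_pi_apply i).comp (WithLp.measurable_ofLp 2 (Fin d → ℝ))
  · exact ((measurable_of_countable fun m : ℕ => (R : ℝ) * 2 ^ m)).comp measurable_shell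

lemma norm_le_shell (hR : 0 < R) (x : EuclideanSpace ℝ (Fin d)) :
    ‖WithLp.ofLp x‖ ≤ R * 2 ^ shell R x := by
  have hR' : (0 : ℝ) < R := hR
  rcases eq_or_lt_of_le (norm_nonneg (WithLp.ofLp x)) with h | h
  · rw [← h]; positivity
  · have h1 : Real.logb 2 (‖WithLp.ofLp x‖ / R) ≤ (shell R x : ℝ) := Nat.le_ceil _
    rw [Real.logb_le_iff_le_rpow (by norm_num) (by positivity), Real.rpow_natCast,
      div_le_iff₀ hR'] at h1
    rwa [mul_comm]

lemma two_pow_shell_le (hR : 0 < R) (x : EuclideanSpace ℝ (Fin d)) :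
    (2 : ℝ) ^ shell R x ≤ max 1 (2 * (‖WithLp.ofLp x‖ / R)) := by
  have hR' : (0 : ℝ) < R := hR
  rcases Nat.eq_zero_or_pos (shell R x) with h | h
  · rw [h, pow_zero]; exact le_max_left _ _
  · refine le_max_of_le_right ?_
    have hpos : 0 < Real.logb 2 (‖WithLp.ofLp x‖ / R) := Nat.ceil_pos.1 h
    have hx : 0 < ‖WithLp.ofLp x‖ := by
      refine (norm_nonneg _).lt_of_ne fun h0 => ?_
      rw [← h0] at hpos
      simp at hpos
    have h1 : (shell R x : ℝ) < Real.logb 2 (‖WithLp.ofLp x‖ / R) + 1 :=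
      Nat.ceil_lt_add_one hpos.le
    have h2 : (shell R x : ℝ) - 1 ≤ Real.logb 2 (‖WithLp.ofLp x‖ / R) := by linarith
    rw [Real.le_logb_iff_rpow_le (by norm_num) (by positivity), Real.rpow_sub_one (by norm_num),
      Real.rpow_natCast] at h2
    linarith

lemma two_pow_shell_rpow_le (hR : 0 < R) {q : ℝ} (hq : 0 ≤ q) (x : EuclideanSpace ℝ (Fin d)) :
    ((2 : ℝ≥0∞) ^ shell R x) ^ q ≤ 1 + 2 ^ q * ((R : ℝ≥0∞) ^ q)⁻¹ * ‖WithLp.ofLp x‖ₑ ^ q := by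
  have hR' : (0 : ℝ) < R := hR
  have h1 : ((2 : ℝ≥0∞) ^ shell R x) ≤ max 1 (2 * (R : ℝ≥0∞)⁻¹ * ‖WithLp.ofLp x‖ₑ) := by
    have h := ENNReal.ofReal_le_ofReal (two_pow_shell_le hR x)
    rw [ENNReal.ofReal_pow (by norm_num), ENNReal.ofReal_max, ENNReal.ofReal_one,
      ENNReal.ofReal_mul (by norm_num), ENNReal.ofReal_div_of_pos hR', ofReal_norm,
      ENNReal.ofReal_coe_nnreal, ENNReal.ofReal_ofNat] at h
    rwa [mul_assoc, mul_comm (R : ℝ≥0∞)⁻¹, ← div_eq_mul_inv]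
  refine (ENNReal.rpow_le_rpow h1 hq).trans ?_
  rw [(ENNReal.monotone_rpow_of_nonneg hq).map_max, ENNReal.one_rpow,
    ENNReal.mul_rpow_of_nonneg _ _ hq, ENNReal.mul_rpow_of_nonneg _ _ hq, ENNReal.inv_rpow]
  exact max_le le_self_add le_add_self

lemma cell_nested (l : ℕ) (x y : EuclideanSpace ℝ (Fin d)) (h : cell R (l + 1) x = cell R (l + 1) y) :
    cell R l x = cell R l y := by
  have hs : shell R x = shell R y := congrArg Prod.fst h
  have hf := congrArg Prod.snd h
  refine Prod.ext hs (funext fun i => ?_)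
  have hfi := congrFun hf i
  simp only [cell, pow_succ] at hfi ⊢
  -- The coarse floor is determined by the fine one, because its lower bounds are read off from
  -- those of the fine floor.
  have key : ∀ (t : ℝ) (m : ℤ), m ≤ ⌊2 ^ l * t⌋ ↔ 2 * m ≤ ⌊2 ^ l * 2 * t⌋ := by
    intro t m
    rw [Int.le_floor, Int.le_floor]
    push_cast
    constructor <;> intro h <;> linarith
  refine eq_of_forall_le_iff fun m => ?_
  rw [key, key, hfi]

lemma edist_le_of_cell_eq (hR : 0 < R) (l : ℕ) (x y : EuclideanSpace ℝ (Fin d))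
    (h : cell R l x = cell R l y) :
    edist x y ≤ ((d * (R * 2 ^ shell R x / 2 ^ l) : ℝ≥0) : ℝ≥0∞) := by
  have hR' : (0 : ℝ) < R := hR
  have hs : shell R x = shell R y := congrArg Prod.fst h
  have hf := congrArg Prod.snd h
  refine (edist_le_mul_edist_ofLp x y).trans ?_
  rw [ENNReal.coe_mul]
  gcongr
  rw [edist_nndist, ENNReal.coe_le_coe, ← NNReal.coe_le_coe, coe_nndist,
    dist_pi_le_iff (NNReal.coe_nonneg _)]
  intro i
  have hfi := congrFun hf i
  simp only [cell] at hfi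
  rw [← hs] at hfi
  have h1 := (Int.abs_sub_lt_one_of_floor_eq_floor hfi).le
  have hpos : (0 : ℝ) < R * 2 ^ shell R x := by positivity
  rw [← mul_sub, ← sub_div, abs_mul, abs_div, abs_of_pos hpos, abs_of_pos (by positivity : (0 : ℝ) < 2 ^ l)]
    at h1
  push_cast
  rw [Real.dist_eq, le_div_iff₀ (by positivity)]
  rw [← mul_div_assoc, div_le_one hpos] at h1
  linarith

lemma cell_snd_mem (hR : 0 < R) (l : ℕ) (x : EuclideanSpace ℝ (Fin d)) :
    (cell R l x).2 ∈ Fintype.piFinset fun _ : Fin d => Finset.Icc (-(2 : ℤ) ^ l) (2 ^ l) := by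
  have hR' : (0 : ℝ) < R := hR
  rw [Fintype.mem_piFinset]
  intro i
  have hpos : (0 : ℝ) < R * 2 ^ shell R x := by positivity
  have h1 : |x i| ≤ R * 2 ^ shell R x := (norm_le_pi_norm (WithLp.ofLp x) i).trans (norm_le_shell hR x)
  have h2 : |x i / (R * 2 ^ shell R x)| ≤ 1 := by
    rwa [abs_div, abs_of_pos hpos, div_le_one hpos]
  obtain ⟨h3, h4⟩ := abs_le.1 h2
  have h5 : (0 : ℝ) < 2 ^ l := by positivity
  rw [Finset.mem_Icc]
  constructor
  · refine Int.le_floor.2 ?_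
    push_cast
    nlinarith
  · have : ⌊(2 : ℝ) ^ l * (x i / (R * 2 ^ shell R x))⌋ ≤ ⌊(2 : ℝ) ^ l⌋ :=
      Int.floor_le_floor (by nlinarith)
    refine this.trans (le_of_eq ?_)
    have : ((2 : ℝ) ^ l) = (((2 : ℤ) ^ l : ℤ) : ℝ) := by push_cast; rfl
    rw [this, Int.floor_intCast]

lemma card_cells_le (l : ℕ) :
    ((Fintype.piFinset fun _ : Fin d => Finset.Icc (-(2 : ℤ) ^ l) (2 ^ l)).card : ℝ)
      ≤ (3 * 2 ^ l) ^ d := by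
  rw [Fintype.card_piFinset_const, Int.card_Icc]
  push_cast
  gcongr
  have h1 : (1 : ℤ) ≤ 2 ^ l := one_le_pow₀ (by norm_num)
  have h2 : (((2 : ℤ) ^ l + 1 - -(2 : ℤ) ^ l).toNat : ℤ) ≤ 3 * 2 ^ l := by
    rw [Int.toNat_of_nonneg (by linarith)]
    linarith
  exact_mod_cast h2

/-- The weight of the cells of level `l` in the shell `m`. -/
noncomputable def cellWeight (d : ℕ) (p : ℝ) (R : ℝ≥0) (l m : ℕ) : ℝ≥0 :=
  (2 * d * R * 2 ^ m / 2 ^ l) ^ p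

/-- The multiscale coupling for the cells. The vanishing of the finest cost is immediate here, since
`ν` has finitely many atoms. -/
lemma wassersteinPow_le_tsum_cells {p : ℝ} (hp : 1 ≤ p) (hR : 0 < R) {n : ℕ} (hn : 1 ≤ n)
    (x : Fin n → EuclideanSpace ℝ (Fin d)) (μ : Measure (EuclideanSpace ℝ (Fin d)))
    [IsProbabilityMeasure μ] {ν : Measure (EuclideanSpace ℝ (Fin d))}
    (hν : ν = empiricalMeasure x) :
    wassersteinPow p ν μ ≤ ∑' t : ℕ × (ℕ × (Fin d → ℤ)), (cellWeight d p R t.1 t.2.1 : ℝ≥0∞) *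
      ((ν (cell R t.1 ⁻¹' {t.2}) - μ (cell R t.1 ⁻¹' {t.2}))
        + (μ (cell R t.1 ⁻¹' {t.2}) - ν (cell R t.1 ⁻¹' {t.2}))) := by
  have hp0 : 0 ≤ p := by linarith
  have : IsProbabilityMeasure ν := hν ▸ isProbabilityMeasure_empiricalMeasure hn x
  -- The factor `2` in `cellWeight` makes the weight of level `l + 1` pay for a displacement inside
  -- a cell of level `l`.
  have hδ : ∀ (l : ℕ) (x y : EuclideanSpace ℝ (Fin d)), cell R l x = cell R l y →
      edist x y ^ p ≤ (cellWeight d p R (l + 1) (cell R (l + 1) x).1 : ℝ≥0∞) := by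
    intro l x y h
    rw [cellWeight, ENNReal.coe_rpow_of_nonneg _ hp0]
    refine ENNReal.rpow_le_rpow ((edist_le_of_cell_eq hR l x y h).trans (le_of_eq ?_)) hp0
    congr 1
    simp only [cell]
    rw [pow_succ]
    field_simp
  -- At the coarsest level the same factor `2` bounds a sum of two radii by twice the larger one.
  have hk : ∀ x y : EuclideanSpace ℝ (Fin d), edist x y ^ p ≤
      (cellWeight d p R 0 (cell R 0 x).1 : ℝ≥0∞) + cellWeight d p R 0 (cell R 0 y).1 := by
    intro x y
    have hnorm : ∀ z : EuclideanSpace ℝ (Fin d), ‖WithLp.ofLp z‖ₑ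
        ≤ ((R * 2 ^ shell R z : ℝ≥0) : ℝ≥0∞) := by
      intro z
      rw [enorm_eq_nnnorm, ENNReal.coe_le_coe, ← NNReal.coe_le_coe]
      push_cast
      exact norm_le_shell hR z
    have hmax : ∀ z : EuclideanSpace ℝ (Fin d), (2 * (d : ℝ≥0∞) * ((R * 2 ^ shell R z : ℝ≥0) : ℝ≥0∞)) ^ p
        = (cellWeight d p R 0 (cell R 0 z).1 : ℝ≥0∞) := by
      intro z
      rw [cellWeight, ENNReal.coe_rpow_of_nonneg _ hp0]
      simp only [cell]
      push_cast
      simp only [pow_zero, div_one]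
      ring_nf
    have hed : edist x y ≤ d * (((R * 2 ^ shell R x : ℝ≥0) : ℝ≥0∞)
        + ((R * 2 ^ shell R y : ℝ≥0) : ℝ≥0∞)) := by
      refine (edist_le_mul_edist_ofLp x y).trans ?_
      rw [ENNReal.coe_natCast]
      gcongr
      rw [edist_eq_enorm_sub]
      exact (enorm_sub_le).trans (add_le_add (hnorm x) (hnorm y))
    rw [← hmax, ← hmax]
    rcases le_total ((R * 2 ^ shell R x : ℝ≥0) : ℝ≥0∞) ((R * 2 ^ shell R y : ℝ≥0) : ℝ≥0∞) with h | h
    · refine le_add_left (ENNReal.rpow_le_rpow (hed.trans ?_) hp0)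
      rw [mul_comm 2 (d : ℝ≥0∞), mul_assoc, two_mul]
      gcongr
    · refine le_add_right (ENNReal.rpow_le_rpow (hed.trans ?_) hp0)
      rw [mul_comm 2 (d : ℝ≥0∞), mul_assoc, two_mul]
      gcongr
  have hlim : Tendsto (fun L => ∫⁻ x, (cellWeight d p R (L + 1) (cell R (L + 1) x).1 : ℝ≥0∞) ∂ν)
      atTop (𝓝 0) := by
    simp only [hν, lintegral_empiricalMeasure]
    have h0 : ∀ i, Tendsto (fun L => (cellWeight d p R (L + 1) (cell R (L + 1) (x i)).1 : ℝ≥0∞))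
        atTop (𝓝 0) := by
      intro i
      rw [← ENNReal.coe_zero, ENNReal.tendsto_coe, ← NNReal.zero_rpow (by linarith : p ≠ 0)]
      refine ((NNReal.continuous_rpow_const hp0).tendsto 0).comp ?_
      have h2 : Tendsto (fun L : ℕ => (2 * d * R * 2 ^ shell R (x i) : ℝ≥0) * (2⁻¹) ^ (L + 1))
          atTop (𝓝 (2 * d * R * 2 ^ shell R (x i) * 0)) :=
        ((NNReal.tendsto_pow_atTop_nhds_zero_of_lt_one
          (by rw [inv_lt_one₀] <;> norm_num)).comp (tendsto_add_atTop_nat 1)).const_mul _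
      rw [mul_zero] at h2
      refine h2.congr fun L => ?_
      simp only [cell]
      rw [div_eq_mul_inv, inv_pow]
    have h1 := tendsto_finsetSum (Finset.univ : Finset (Fin n)) fun i _ => h0 i
    have h2 := ENNReal.Tendsto.const_mul (a := (n : ℝ≥0∞)⁻¹) h1
      (Or.inr (by simpa using (by omega : n ≠ 0)))
    simpa using h2
  have hmain := iInf_coupling_le_of_nested_partitions (f := fun l => cell R l) measurable_cell
    cell_nested (c := fun z => edist z.1 z.2 ^ p) (by fun_prop)
    (δ := fun l i => cellWeight d p R (l + 1) i.1) (k := fun i => cellWeight d p R 0 i.1)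
    hδ hk ν μ hlim
  refine hmain.trans ?_
  set G : ℕ → ℕ × (Fin d → ℤ) → ℝ≥0∞ := fun l i => (cellWeight d p R l i.1 : ℝ≥0∞) *
    ((ν (cell R l ⁻¹' {i}) - μ (cell R l ⁻¹' {i}))
      + (μ (cell R l ⁻¹' {i}) - ν (cell R l ⁻¹' {i}))) with hG
  have hsplit : ∑' t : ℕ × (ℕ × (Fin d → ℤ)), G t.1 t.2
      = ∑' i, G 0 i + ∑' l, ∑' i, G (l + 1) i :=
    (ENNReal.tsum_prod (f := G)).trans (tsum_eq_zero_add' ENNReal.summable)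
  refine le_trans ?_ hsplit.ge
  rw [add_comm]
  refine add_le_add le_rfl (ENNReal.tsum_le_tsum fun l => ENNReal.tsum_le_tsum fun i => ?_)
  -- Levels above `0` need only one sign of the discrepancy; adding the other makes the family
  -- uniform in the level.
  exact mul_le_mul' le_rfl le_self_add

end Cells

/-! ### Moment estimates on shells and cells -/

section Moments

variable {d : ℕ} {R : ℝ≥0}

/-- With `R` at least the norm of order `q`, the scale `2 ^ shell` has a moment bounded
independently of `μ` and `R`. -/
lemma lintegral_two_pow_shell_le {q : ℝ} (hq : 0 < q) (hR : 0 < R)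
    (μ : Measure (EuclideanSpace ℝ (Fin d))) [IsProbabilityMeasure μ]
    (hμ : supNormMoment q μ ≤ (R : ℝ≥0∞) ^ q) :
    ∫⁻ x, ((2 : ℝ≥0∞) ^ shell R x) ^ q ∂μ ≤ 1 + 2 ^ q := by
  have hRq0 : (R : ℝ≥0∞) ^ q ≠ 0 := (ENNReal.rpow_pos (by simpa using hR) (by simp)).ne'
  have hRqt : (R : ℝ≥0∞) ^ q ≠ ∞ := ENNReal.rpow_ne_top_of_nonneg hq.le (by simp)
  refine (lintegral_mono (two_pow_shell_rpow_le hR hq.le)).trans ?_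
  rw [lintegral_add_left measurable_const, lintegral_const_mul' _ _
    (ENNReal.mul_ne_top (ENNReal.rpow_ne_top_of_nonneg hq.le (by simp)) (ENNReal.inv_ne_top.2 hRq0))]
  simp only [lintegral_const, measure_univ, mul_one]
  gcongr
  calc 2 ^ q * ((R : ℝ≥0∞) ^ q)⁻¹ * ∫⁻ x, ‖WithLp.ofLp x‖ₑ ^ q ∂μ
      ≤ 2 ^ q * ((R : ℝ≥0∞) ^ q)⁻¹ * (R : ℝ≥0∞) ^ q := by gcongr; exact hμ
    _ = 2 ^ q := by rw [mul_assoc, ENNReal.inv_mul_cancel hRq0 hRqt, mul_one]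

lemma measureReal_shell_le {q : ℝ} (hq : 0 < q) (hR : 0 < R)
    (μ : Measure (EuclideanSpace ℝ (Fin d))) [IsProbabilityMeasure μ]
    (hμ : supNormMoment q μ ≤ (R : ℝ≥0∞) ^ q) (m : ℕ) :
    μ.real (shell R ⁻¹' {m}) ≤ (1 + 2 ^ q) * 2 ^ (-(q * m)) := by
  have hS : MeasurableSet (shell R ⁻¹' {m} : Set (EuclideanSpace ℝ (Fin d))) :=
    measurable_shell (measurableSet_singleton m)
  have h1 : ((2 : ℝ≥0∞) ^ m) ^ q * μ (shell R ⁻¹' {m}) ≤ 1 + 2 ^ q := by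
    refine le_trans ?_ (lintegral_two_pow_shell_le hq hR μ hμ)
    rw [← setLIntegral_const]
    refine (setLIntegral_mono_ae' hS ?_).trans (setLIntegral_le_lintegral _ _)
    refine Eventually.of_forall fun x hx => ?_
    rw [show shell R x = m from hx]
  have h2 := ENNReal.toReal_mono (by
    exact ENNReal.add_ne_top.2 ⟨by simp, ENNReal.rpow_ne_top_of_nonneg hq.le (by simp)⟩) h1
  rw [ENNReal.toReal_mul, ← ENNReal.toReal_rpow, ENNReal.toReal_pow, ENNReal.toReal_add (by simp)
    (ENNReal.rpow_ne_top_of_nonneg hq.le (by simp)), ← ENNReal.toReal_rpow] at h2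
  simp only [ENNReal.toReal_ofNat, ENNReal.toReal_one] at h2
  rw [← Real.rpow_natCast, ← Real.rpow_mul (by norm_num), mul_comm (m : ℝ) q] at h2
  rw [Real.rpow_neg (by norm_num), ← div_eq_mul_inv, le_div_iff₀ (by positivity), mul_comm]
  exact h2

/-- At each level exactly one cell contains `y`, and since `p ≥ 1` the weights decay at least like
`2 ^ (-l)`; the factor `2` is the sum of that series. The left side is the bounded-difference
function `g`. -/
lemma tsum_cellWeight_indicator_le {p : ℝ} (hp : 1 ≤ p) (y : EuclideanSpace ℝ (Fin d)) :
    ∑' t : ℕ × (ℕ × (Fin d → ℤ)), (cellWeight d p R t.1 t.2.1 : ℝ≥0∞) *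
      (cell R t.1 ⁻¹' {t.2}).indicator 1 y
      ≤ 2 * (2 * d * R : ℝ≥0∞) ^ p * ((2 : ℝ≥0∞) ^ shell R y) ^ p := by
  have hp0 : 0 ≤ p := by linarith
  have hsplit : ∑' t : ℕ × (ℕ × (Fin d → ℤ)), (cellWeight d p R t.1 t.2.1 : ℝ≥0∞) *
      (cell R t.1 ⁻¹' {t.2}).indicator (1 : EuclideanSpace ℝ (Fin d) → ℝ≥0∞) y
      = ∑' l, ∑' i : ℕ × (Fin d → ℤ), (cellWeight d p R l i.1 : ℝ≥0∞) *
        (cell R l ⁻¹' {i}).indicator (1 : EuclideanSpace ℝ (Fin d) → ℝ≥0∞) y :=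
    ENNReal.tsum_prod (f := fun l (i : ℕ × (Fin d → ℤ)) => (cellWeight d p R l i.1 : ℝ≥0∞) *
        (cell R l ⁻¹' {i}).indicator (1 : EuclideanSpace ℝ (Fin d) → ℝ≥0∞) y)
  rw [hsplit]
  have hterm : ∀ l, ∑' i : ℕ × (Fin d → ℤ), (cellWeight d p R l i.1 : ℝ≥0∞) *
        (cell R l ⁻¹' {i}).indicator (1 : EuclideanSpace ℝ (Fin d) → ℝ≥0∞) y
      ≤ (2 * d * R : ℝ≥0∞) ^ p * ((2 : ℝ≥0∞) ^ shell R y) ^ p * 2⁻¹ ^ l := by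
    intro l
    rw [tsum_eq_single (cell R l y)]
    · have hmem : y ∈ cell R l ⁻¹' {cell R l y} := rfl
      rw [Set.indicator_of_mem hmem, Pi.one_apply, mul_one, cellWeight,
        ENNReal.coe_rpow_of_nonneg _ hp0, ← ENNReal.mul_rpow_of_nonneg _ _ hp0]
      have h1 : ((2 * d * R * 2 ^ (cell R l y).1 / 2 ^ l : ℝ≥0) : ℝ≥0∞)
          = (2 * d * R * 2 ^ shell R y) * 2⁻¹ ^ l := by
        rw [ENNReal.coe_div (by positivity), div_eq_mul_inv]
        push_cast
        rw [ENNReal.inv_pow]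
        rfl
      rw [h1, ENNReal.mul_rpow_of_nonneg _ _ hp0]
      gcongr
      refine ENNReal.rpow_le_self_of_le_one ?_ hp
      exact pow_le_one₀ (by simp) (by simp)
    · intro i hi
      have hmem : y ∉ cell R l ⁻¹' {i} := fun h => hi (Eq.symm h)
      rw [Set.indicator_of_notMem hmem, mul_zero]
  refine (ENNReal.tsum_le_tsum hterm).trans (le_of_eq ?_)
  rw [ENNReal.tsum_mul_left, ENNReal.tsum_geometric, ENNReal.one_sub_inv_two, inv_inv]
  ring

/-- The power mean inequality with exponent `1 / (1 - v)`. -/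
lemma sum_rpow_one_sub_le {κ : Type*} (s : Finset κ) {a : κ → ℝ} (ha : ∀ i ∈ s, 0 ≤ a i) {v : ℝ}
    (hv0 : 0 ≤ v) (hv1 : v < 1) :
    ∑ i ∈ s, a i ^ (1 - v) ≤ (s.card : ℝ) ^ v * (∑ i ∈ s, a i) ^ (1 - v) := by
  have hq : 0 < 1 - v := by linarith
  have h := Real.rpow_sum_le_const_mul_sum_rpow_of_nonneg s (f := fun i => a i ^ (1 - v))
    (p := (1 - v)⁻¹) (one_le_inv₀ hq |>.2 (by linarith))
    (fun i hi => Real.rpow_nonneg (ha i hi) _)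
  have h1 : ∑ i ∈ s, (a i ^ (1 - v)) ^ (1 - v)⁻¹ = ∑ i ∈ s, a i :=
    Finset.sum_congr rfl fun i hi => by
      rw [← Real.rpow_mul (ha i hi), mul_inv_cancel₀ hq.ne', Real.rpow_one]
  rw [h1] at h
  have hs0 : 0 ≤ ∑ i ∈ s, a i ^ (1 - v) := Finset.sum_nonneg fun i hi => Real.rpow_nonneg (ha i hi) _
  have h2 := Real.rpow_le_rpow (Real.rpow_nonneg hs0 _) h hq.le
  rw [← Real.rpow_mul hs0, inv_mul_cancel₀ hq.ne', Real.rpow_one, Real.mul_rpow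
    (Real.rpow_nonneg (Nat.cast_nonneg _) _) (Finset.sum_nonneg ha),
    ← Real.rpow_mul (Nat.cast_nonneg _)] at h2
  convert h2 using 3
  field_simp
  ring

lemma min_sqrt_le_rpow {a v : ℝ} (ha : 0 ≤ a) (hv0 : 0 ≤ v) (hv1 : v ≤ 1 / 2) :
    min a √a ≤ a ^ (1 - v) := by
  rcases eq_or_lt_of_le ha with rfl | ha0
  · simp [Real.zero_rpow (by linarith : 1 - v ≠ 0)]
  rcases le_total a 1 with h | h
  · refine (min_le_left _ _).trans ?_
    conv_lhs => rw [← Real.rpow_one a]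
    exact Real.rpow_le_rpow_of_exponent_ge ha0 h (by linarith)
  · refine (min_le_right _ _).trans ?_
    rw [Real.sqrt_eq_rpow]
    exact Real.rpow_le_rpow_of_exponent_le h (by linarith)

/-- Only the number of cubes in a shell and the total mass of the shell enter, whatever the
distribution of `μ` inside it. -/
lemma sum_cells_min_le (hR : 0 < R) (μ : Measure (EuclideanSpace ℝ (Fin d)))
    [IsProbabilityMeasure μ] (n l m : ℕ) {v : ℝ} (hv0 : 0 ≤ v) (hv1 : v ≤ 1 / 2) :
    ∑' k : Fin d → ℤ, ENNReal.ofReal (min (n * μ.real (cell R l ⁻¹' {(m, k)}))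
        √(n * μ.real (cell R l ⁻¹' {(m, k)})))
      ≤ ENNReal.ofReal (((3 * 2 ^ l) ^ d : ℝ) ^ v * (n * μ.real (shell R ⁻¹' {m})) ^ (1 - v)) := by
  set s := Fintype.piFinset fun _ : Fin d => Finset.Icc (-(2 : ℤ) ^ l) (2 ^ l) with hs
  rw [tsum_eq_sum (s := s)]
  · rw [← ENNReal.ofReal_sum_of_nonneg fun k _ => by positivity]
    refine ENNReal.ofReal_le_ofReal ?_
    calc ∑ k ∈ s, min (n * μ.real (cell R l ⁻¹' {(m, k)})) √(n * μ.real (cell R l ⁻¹' {(m, k)}))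
        ≤ ∑ k ∈ s, (n * μ.real (cell R l ⁻¹' {(m, k)})) ^ (1 - v) :=
          Finset.sum_le_sum fun k _ => min_sqrt_le_rpow (by positivity) hv0 hv1
      _ ≤ (s.card : ℝ) ^ v * (∑ k ∈ s, n * μ.real (cell R l ⁻¹' {(m, k)})) ^ (1 - v) :=
          sum_rpow_one_sub_le s (fun k _ => by positivity) hv0 (by linarith)
      _ ≤ _ := by
          gcongr
          · exact card_cells_le l
          · linarith
          · rw [← Finset.mul_sum]
            gcongr
            rw [← measureReal_biUnion_finset]
            · refine measureReal_mono ?_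
              intro x hx
              simp only [Set.mem_iUnion] at hx
              obtain ⟨k, _, hk⟩ := hx
              exact congrArg Prod.fst (show cell R l x = (m, k) from hk)
            · intro k _ k' _ hkk'
              refine Disjoint.preimage _ ?_
              simpa using hkk'
            · exact fun k _ => measurable_cell l (measurableSet_singleton _)
  · intro k hk
    have : cell R l ⁻¹' {(m, k)} = (∅ : Set (EuclideanSpace ℝ (Fin d))) := by
      refine Set.eq_empty_of_forall_notMem fun x hx => hk ?_
      have h1 := cell_snd_mem hR l x
      rwa [show cell R l x = (m, k) from hx] at h1
    simp [this]

/-- In powers of two, the shell contributes `p * m - r * p * m * (1 - v)` (weight times tail) and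
the level contributes `d * l * v - p * l` (number of cubes times weight). The two factors are
written with separate bases to match `exists_tsum_tsum_le`. -/
lemma sum_weighted_cells_le (hd : 1 ≤ d) {p r : ℝ} (hp : 1 ≤ p) (hr₁ : 1 < r) (hR : 0 < R)
    (μ : Measure (EuclideanSpace ℝ (Fin d))) [IsProbabilityMeasure μ]
    (hμ : supNormMoment (r * p) μ ≤ (R : ℝ≥0∞) ^ (r * p)) {n : ℕ} (hn : 1 ≤ n) (l m : ℕ) {v : ℝ}
    (hv0 : 0 ≤ v) (hv1 : v ≤ 1 / 2) :
    ∑' k : Fin d → ℤ, (cellWeight d p R l m : ℝ≥0∞) *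
      (2 * ENNReal.ofReal (min (n * μ.real (cell R l ⁻¹' {(m, k)}))
        √(n * μ.real (cell R l ⁻¹' {(m, k)}))))
      ≤ ENNReal.ofReal (2 * (2 * d * R) ^ p * (3 ^ d * (1 + 2 ^ (r * p))) * n) *
        ENNReal.ofReal ((n : ℝ) ^ (-v) * (2 ^ (p * r) : ℝ) ^ ((m : ℝ) * (v - (r - 1) / r))
          * (2 ^ (d : ℝ) : ℝ) ^ ((l : ℝ) * (v - p / d))) := by
  have hp0 : 0 ≤ p := by linarith
  have hn0 : (0 : ℝ) < n := by exact_mod_cast hn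
  have hd0 : (0 : ℝ) < d := by exact_mod_cast hd
  have hR' : (0 : ℝ) < R := hR
  have hP := measureReal_shell_le (by positivity : 0 < r * p) hR μ hμ m
  rw [ENNReal.tsum_mul_left, ENNReal.tsum_mul_left]
  refine (mul_le_mul' le_rfl (mul_le_mul' le_rfl (sum_cells_min_le hR μ n l m hv0 hv1))).trans ?_
  have htwo : ∀ z : ℝ, 2 * ENNReal.ofReal z = ENNReal.ofReal (2 * z) := fun z => by
    rw [ENNReal.ofReal_mul (by norm_num), ENNReal.ofReal_ofNat]
  rw [← ENNReal.ofReal_coe_nnreal, htwo, ← ENNReal.ofReal_mul (NNReal.coe_nonneg _), ← ENNReal.ofReal_mul (by positivity)]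
  refine ENNReal.ofReal_le_ofReal ?_
  set K : ℝ := 1 + 2 ^ (r * p) with hK
  have hK1 : 1 ≤ K := by
    have : (0 : ℝ) ≤ 2 ^ (r * p) := by positivity
    linarith
  have hw : (cellWeight d p R l m : ℝ) = (2 * d * R) ^ p * (2 ^ (p * m) * 2 ^ (-(p * l))) := by
    rw [cellWeight]
    push_cast
    rw [Real.div_rpow (by positivity) (by positivity), Real.mul_rpow (by positivity) (by positivity),
      ← Real.rpow_natCast 2 m, ← Real.rpow_natCast 2 l, ← Real.rpow_mul (by norm_num),
      ← Real.rpow_mul (by norm_num), Real.rpow_neg (by norm_num), mul_comm p m, mul_comm p l]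
    ring
  have h3 : ((3 * 2 ^ l) ^ d : ℝ) ^ v ≤ 3 ^ d * 2 ^ (d * l * v) := by
    rw [mul_pow, Real.mul_rpow (by positivity) (by positivity)]
    refine mul_le_mul ?_ (le_of_eq ?_) (by positivity) (by positivity)
    · conv_rhs => rw [← Real.rpow_one ((3 : ℝ) ^ d)]
      exact Real.rpow_le_rpow_of_exponent_le (one_le_pow₀ (by norm_num)) (by linarith)
    · rw [← pow_mul, ← Real.rpow_natCast, ← Real.rpow_mul (by norm_num)]
      congr 1
      push_cast
      ring
  have h4 : (n * μ.real (shell R ⁻¹' {m})) ^ (1 - v)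
      ≤ n * n ^ (-v) * (K * 2 ^ (-(r * p * m) * (1 - v))) := by
    calc (n * μ.real (shell R ⁻¹' {m})) ^ (1 - v)
        ≤ (n * (K * 2 ^ (-(r * p * m)))) ^ (1 - v) := by
          gcongr
          linarith
      _ = n ^ (1 - v) * (K ^ (1 - v) * 2 ^ (-(r * p * m) * (1 - v))) := by
          rw [Real.mul_rpow (by positivity) (by positivity),
            Real.mul_rpow (by positivity) (by positivity), ← Real.rpow_mul (by norm_num)]
      _ ≤ n * n ^ (-v) * (K * 2 ^ (-(r * p * m) * (1 - v))) := by
          rw [sub_eq_add_neg 1 v, Real.rpow_add hn0, Real.rpow_one]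
          gcongr
          conv_rhs => rw [← Real.rpow_one K]
          exact Real.rpow_le_rpow_of_exponent_le hK1 (by linarith)
  calc (cellWeight d p R l m : ℝ) * (2 * (((3 * 2 ^ l) ^ d : ℝ) ^ v
        * (n * μ.real (shell R ⁻¹' {m})) ^ (1 - v)))
      ≤ (2 * d * R) ^ p * (2 ^ (p * m) * 2 ^ (-(p * l))) * (2 * ((3 ^ d * 2 ^ (d * l * v))
        * (n * n ^ (-v) * (K * 2 ^ (-(r * p * m) * (1 - v)))))) := by
        rw [hw]
        gcongr
    _ = 2 * (2 * d * R) ^ p * (3 ^ d * K) * n * (n ^ (-v)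
          * (2 ^ (p * m) * 2 ^ (-(r * p * m) * (1 - v))) * (2 ^ (-(p * l)) * 2 ^ (d * l * v))) := by
        ring
    _ = _ := by
        rw [← Real.rpow_add (by norm_num), ← Real.rpow_add (by norm_num),
          ← Real.rpow_mul (by norm_num), ← Real.rpow_mul (by norm_num)]
        congr 3
        · congr 1
          field_simp
          ring
        · field_simp
          ring

end Moments

/-! ### The moment bound on the product space -/

section MomentBound

variable {d : ℕ}

/-- `v` is the smaller one of the exponents `(r - 1) / r` and `p / d`, and these differ. -/
def IsRateExponent (d : ℕ) (p r v : ℝ) : Prop :=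
  v = (r - 1) / r ∧ v < p / d ∨ v = p / d ∧ v < (r - 1) / r

lemma exists_tsum_cells_le (hd : 1 ≤ d) {p r v : ℝ} (hp : 1 ≤ p) (hr₁ : 1 < r) (hr₂ : r < 2)
    (hv : IsRateExponent d p r v) : ∃ C : ℝ≥0, ∀ (R : ℝ≥0) (n : ℕ)
      (μ : Measure (EuclideanSpace ℝ (Fin d))), IsProbabilityMeasure μ → 0 < R → 1 ≤ n →
      supNormMoment (r * p) μ ≤ (R : ℝ≥0∞) ^ (r * p) →
      ∑' t : ℕ × (ℕ × (Fin d → ℤ)), (cellWeight d p R t.1 t.2.1 : ℝ≥0∞) *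
        (2 * ENNReal.ofReal (min (n * μ.real (cell R t.1 ⁻¹' {t.2}))
          √(n * μ.real (cell R t.1 ⁻¹' {t.2}))))
      ≤ C * (2 * d * R : ℝ≥0∞) ^ p * (n * ((n : ℝ≥0∞) ^ v)⁻¹) := by
  have hd0 : (0 : ℝ) < d := by exact_mod_cast hd
  have hv₀ : 0 < (r - 1) / r := by have : 0 < r - 1 := by linarith
                                   positivity
  have hv₁ : (r - 1) / r < 1 / 2 := by rw [div_lt_div_iff₀ (by linarith) (by norm_num)]; linarith
  have hb₁ : (1 : ℝ) < 2 ^ (p * r) := Real.one_lt_rpow (by norm_num) (by nlinarith)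
  have hb₂ : (1 : ℝ) < 2 ^ (d : ℝ) := Real.one_lt_rpow (by norm_num) hd0
  obtain ⟨C, hC⟩ : ∃ C : ℝ≥0, ∀ (n : ℕ) (c : ℝ≥0∞) (a : ℕ → ℕ → ℝ≥0∞), 1 ≤ n →
      (∀ l m u, 0 ≤ u → u ≤ 1 / 2 → a l m ≤ c * ENNReal.ofReal ((n : ℝ) ^ (-u)
        * (2 ^ (p * r) : ℝ) ^ ((m : ℝ) * (u - (r - 1) / r))
        * (2 ^ (d : ℝ) : ℝ) ^ ((l : ℝ) * (u - p / d)))) →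
      ∑' l, ∑' m, a l m ≤ c * (C * ENNReal.ofReal ((n : ℝ) ^ (-v))) := by
    -- The index with the smaller exponent plays the role of `i`, the peaked sum: the shell `m` when
    -- `(r - 1) / r` is smaller, the level `l` when `p / d` is.
    rcases hv with ⟨rfl, h⟩ | ⟨rfl, h⟩
    · obtain ⟨C, hC⟩ := exists_tsum_tsum_le hb₁ hb₂ h hv₀ hv₁
      refine ⟨C, fun n c a hn ha => ?_⟩
      rw [ENNReal.tsum_comm]
      exact hC n c (fun m l => a l m) hn fun m l u hu0 hu1 => ha l m u hu0 hu1
    · obtain ⟨C, hC⟩ := exists_tsum_tsum_le hb₂ hb₁ h (by positivity) (h.trans hv₁)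
      refine ⟨C, fun n c a hn ha => hC n c a hn fun l m u hu0 hu1 => ?_⟩
      rw [mul_right_comm]
      exact ha l m u hu0 hu1
  set K : ℝ := 3 ^ d * (1 + 2 ^ (r * p)) with hK
  refine ⟨Real.toNNReal (2 * K) * C, fun R n μ hμp hR hn hμ => ?_⟩
  have hn0 : (0 : ℝ) < n := by exact_mod_cast hn
  set F : ℕ → ℕ × (Fin d → ℤ) → ℝ≥0∞ := fun l i => (cellWeight d p R l i.1 : ℝ≥0∞) *
        (2 * ENNReal.ofReal (min (n * μ.real (cell R l ⁻¹' {i}))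
          √(n * μ.real (cell R l ⁻¹' {i})))) with hF
  have hsplit : ∑' t : ℕ × (ℕ × (Fin d → ℤ)), F t.1 t.2 = ∑' l, ∑' m, ∑' k, F l (m, k) := by
    refine (ENNReal.tsum_prod (f := F)).trans (tsum_congr fun l => ?_)
    exact ENNReal.tsum_prod (f := fun m k => F l (m, k))
  refine hsplit.le.trans ((hC n (ENNReal.ofReal (2 * (2 * d * R) ^ p * K * n)) _ hn
    fun l m u hu0 hu1 => sum_weighted_cells_le hd hp hr₁ hR μ hμ hn l m hu0 hu1).trans ?_)
  refine le_of_eq ?_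
  have h1 : ENNReal.ofReal ((n : ℝ) ^ (-v)) = ((n : ℝ≥0∞) ^ v)⁻¹ := by
    rw [← ENNReal.ofReal_rpow_of_pos hn0, ENNReal.ofReal_natCast, ENNReal.rpow_neg]
  have h2 : ENNReal.ofReal (2 * (2 * d * R) ^ p * K * n)
      = ENNReal.ofReal (2 * K) * (2 * d * R : ℝ≥0∞) ^ p * n := by
    rw [show 2 * (2 * d * R) ^ p * K * n = (2 * K) * (2 * d * (R : ℝ)) ^ p * n by ring,
      ENNReal.ofReal_mul (p := (2 * K) * (2 * d * (R : ℝ)) ^ p) (by positivity),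
      ENNReal.ofReal_mul (p := 2 * K) (by positivity),
      ENNReal.ofReal_natCast, ← ENNReal.ofReal_rpow_of_nonneg (by positivity) (by linarith),
      ENNReal.ofReal_mul (p := 2 * (d : ℝ)) (by positivity),
      ENNReal.ofReal_mul (p := 2) (q := (d : ℝ)) (by norm_num), ENNReal.ofReal_natCast,
      ENNReal.ofReal_coe_nnreal, ENNReal.ofReal_ofNat]
  rw [h1, h2, ENNReal.coe_mul, ENNReal.ofReal]
  ring

lemma maxWassersteinPow_le_iSup_maxDeviation {p : ℝ} (hp : 1 ≤ p) {R : ℝ≥0} (hR : 0 < R) {n : ℕ}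
    (x : Fin n → EuclideanSpace ℝ (Fin d)) (μ : Measure (EuclideanSpace ℝ (Fin d)))
    [IsProbabilityMeasure μ] :
    maxWassersteinPow p x μ ≤ ⨆ T : Finset (ℕ × (ℕ × (Fin d → ℤ))),
      ENNReal.ofReal (maxDeviation μ (fun t => cell R t.1 ⁻¹' {t.2})
        (fun t => (cellWeight d p R t.1 t.2.1 : ℝ)) T x) := by
  refine iSup_le fun j => ?_
  refine le_trans (mul_le_mul' le_rfl (wassersteinPow_le_tsum_cells hp hR (Nat.le_add_left 1 _)
    (fun i : Fin (j.val + 1) => x (Fin.castLE j.isLt i)) μ rfl)) ?_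
  exact mul_tsum_deviation_le μ (A := fun t : ℕ × (ℕ × (Fin d → ℤ)) => cell R t.1 ⁻¹' {t.2})
    (fun t => measurable_cell t.1 (measurableSet_singleton _))
    (fun t => cellWeight d p R t.1 t.2.1) x (Nat.le_add_left 1 _) j.isLt rfl

/-- The scale `R` is a free parameter here, so that a law with zero moment needs no separate
treatment. -/
lemma exists_lintegral_maxWassersteinPow_le_radius (hd : 1 ≤ d) {p r v : ℝ} (hp : 1 ≤ p)
    (hr₁ : 1 < r) (hr₂ : r < 2) (hv : IsRateExponent d p r v) : ∃ C : ℝ≥0, 0 < C ∧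
      ∀ (R : ℝ≥0) (n : ℕ) (μ : Measure (EuclideanSpace ℝ (Fin d))), IsProbabilityMeasure μ →
      0 < R → 1 ≤ n → supNormMoment (r * p) μ ≤ (R : ℝ≥0∞) ^ (r * p) →
      (∫⁻ x : Fin n → EuclideanSpace ℝ (Fin d), maxWassersteinPow p x μ ^ r
        ∂(Measure.pi fun _ => μ)) / (n : ℝ≥0∞) ^ r
      ≤ C * ((R : ℝ≥0∞) ^ (r * p) / (n : ℝ≥0∞) ^ (r * v)) := by
  obtain ⟨C, hC⟩ := exists_tsum_cells_le hd hp hr₁ hr₂ hv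
  have hp0 : 0 ≤ p := by linarith
  have hr0 : 0 ≤ r := by linarith
  have hrp : 0 < r * p := by nlinarith
  have hvr : r * v ≤ r - 1 := by
    have hle : v ≤ (r - 1) / r := by
      rcases hv with ⟨h, _⟩ | ⟨_, h⟩
      · exact h.le
      · exact h.le
    rwa [le_div_iff₀ (by linarith), mul_comm] at hle
  set D : ℝ≥0 := (32 * 2 ^ r * (1 + 2 ^ (r * p)) + 2 * C ^ r) * (2 * d) ^ (r * p) with hD
  have hd0 : (0 : ℝ≥0) < d := by exact_mod_cast hd
  have hDpos : 0 < D := by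
    have h1 : (0 : ℝ≥0) < (2 * d) ^ (r * p) := NNReal.rpow_pos (by positivity)
    have h2 : (0 : ℝ≥0) < 2 ^ r := NNReal.rpow_pos (by norm_num)
    positivity
  refine ⟨D, hDpos, fun R n μ hμp hR hn hμ => ?_⟩
  have hn0 : (n : ℝ≥0∞) ≠ 0 := by simpa using (by omega : n ≠ 0)
  have hnt : (n : ℝ≥0∞) ≠ ∞ := by simp
  have hn1 : (1 : ℝ≥0∞) ≤ n := by exact_mod_cast hn
  set Λ : ℝ≥0∞ := (2 * d * R : ℝ≥0∞) ^ p with hΛ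
  have hΛr : Λ ^ r = (2 * d : ℝ≥0∞) ^ (r * p) * (R : ℝ≥0∞) ^ (r * p) := by
    rw [hΛ, ← ENNReal.rpow_mul, mul_comm p r, ENNReal.mul_rpow_of_nonneg _ _ hrp.le]
  have hA : ∀ t : ℕ × (ℕ × (Fin d → ℤ)), MeasurableSet
      (cell R t.1 ⁻¹' {t.2} : Set (EuclideanSpace ℝ (Fin d))) :=
    fun t => measurable_cell t.1 (measurableSet_singleton _)
  have h1 : ∫⁻ x : Fin n → EuclideanSpace ℝ (Fin d), maxWassersteinPow p x μ ^ r
        ∂(Measure.pi fun _ => μ)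
      ≤ 32 * n * ((2 ^ r * Λ ^ r) * (1 + 2 ^ (r * p)))
        + 2 * (C * Λ * (n * ((n : ℝ≥0∞) ^ v)⁻¹)) ^ r := by
    refine (lintegral_mono fun x => ENNReal.rpow_le_rpow
      (maxWassersteinPow_le_iSup_maxDeviation hp hR x μ) hr0).trans ?_
    refine (lintegral_iSup_maxDeviation_rpow_le μ hA _ n hr₁ hr₂).trans ?_
    refine add_le_add (mul_le_mul' le_rfl ?_)
      (mul_le_mul' le_rfl (ENNReal.rpow_le_rpow (hC R n μ hμp hR hn hμ) hr0))
    calc ∫⁻ y, (∑' t : ℕ × (ℕ × (Fin d → ℤ)), (cellWeight d p R t.1 t.2.1 : ℝ≥0∞) *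
          (cell R t.1 ⁻¹' {t.2}).indicator 1 y) ^ r ∂μ
        ≤ ∫⁻ y, (2 ^ r * Λ ^ r) * ((2 : ℝ≥0∞) ^ shell R y) ^ (r * p) ∂μ := by
          refine lintegral_mono fun y => ?_
          refine (ENNReal.rpow_le_rpow (tsum_cellWeight_indicator_le hp y) hr0).trans (le_of_eq ?_)
          rw [ENNReal.mul_rpow_of_nonneg _ _ hr0, ENNReal.mul_rpow_of_nonneg _ _ hr0,
            ← ENNReal.rpow_mul ((2 : ℝ≥0∞) ^ shell R y), mul_comm p r]
      _ = (2 ^ r * Λ ^ r) * ∫⁻ y, ((2 : ℝ≥0∞) ^ shell R y) ^ (r * p) ∂μ := by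
          refine lintegral_const_mul' _ _ (ENNReal.mul_ne_top
            (ENNReal.rpow_ne_top_of_nonneg hr0 (by simp))
            (ENNReal.rpow_ne_top_of_nonneg hr0 (ENNReal.rpow_ne_top_of_nonneg hp0 ?_)))
          exact ENNReal.mul_ne_top (ENNReal.mul_ne_top (by simp) (by simp)) (by simp)
      _ ≤ _ := mul_le_mul' le_rfl (lintegral_two_pow_shell_le hrp hR μ hμ)
  -- The fluctuation term is never the larger one, because `r * v ≤ r - 1`.
  have h2 : (n : ℝ≥0∞) / (n : ℝ≥0∞) ^ r ≤ ((n : ℝ≥0∞) ^ (r * v))⁻¹ := by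
    rw [← ENNReal.rpow_neg, div_eq_mul_inv, ← ENNReal.rpow_neg]
    nth_rewrite 1 [← ENNReal.rpow_one (n : ℝ≥0∞)]
    rw [← ENNReal.rpow_add _ _ hn0 hnt]
    exact ENNReal.rpow_le_rpow_of_exponent_le hn1 (by linarith)
  have h3 : (n * ((n : ℝ≥0∞) ^ v)⁻¹) ^ r / (n : ℝ≥0∞) ^ r = ((n : ℝ≥0∞) ^ (r * v))⁻¹ := by
    rw [ENNReal.mul_rpow_of_nonneg _ _ hr0, ENNReal.inv_rpow, ← ENNReal.rpow_mul, mul_comm v r,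
      mul_comm, mul_div_assoc, ENNReal.div_self, mul_one]
    · exact (ENNReal.rpow_pos (pos_iff_ne_zero.2 hn0) hnt).ne'
    · exact ENNReal.rpow_ne_top_of_nonneg hr0 hnt
  calc (∫⁻ x : Fin n → EuclideanSpace ℝ (Fin d), maxWassersteinPow p x μ ^ r
        ∂(Measure.pi fun _ => μ)) / (n : ℝ≥0∞) ^ r
      ≤ (32 * n * ((2 ^ r * Λ ^ r) * (1 + 2 ^ (r * p)))
        + 2 * (C * Λ * (n * ((n : ℝ≥0∞) ^ v)⁻¹)) ^ r) / (n : ℝ≥0∞) ^ r :=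
        ENNReal.div_le_div_right h1 _
    _ = 32 * 2 ^ r * (1 + 2 ^ (r * p)) * Λ ^ r * (n / (n : ℝ≥0∞) ^ r)
        + 2 * C ^ r * Λ ^ r * ((n * ((n : ℝ≥0∞) ^ v)⁻¹) ^ r / (n : ℝ≥0∞) ^ r) := by
        rw [ENNReal.mul_rpow_of_nonneg _ _ hr0, ENNReal.mul_rpow_of_nonneg _ _ hr0]
        simp only [div_eq_mul_inv]
        ring
    _ ≤ 32 * 2 ^ r * (1 + 2 ^ (r * p)) * Λ ^ r * ((n : ℝ≥0∞) ^ (r * v))⁻¹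
        + 2 * C ^ r * Λ ^ r * ((n : ℝ≥0∞) ^ (r * v))⁻¹ := by
        rw [h3]
        gcongr
    _ = _ := by
        rw [hΛr, hD]
        simp only [ENNReal.coe_mul, ENNReal.coe_add, ENNReal.coe_rpow_of_nonneg _ hr0,
          ENNReal.coe_rpow_of_nonneg _ hrp.le, ENNReal.coe_natCast, ENNReal.coe_one,
          ENNReal.coe_ofNat, div_eq_mul_inv]
        ring

/-- The moment bound for the maximum over `k ≤ n` of `k` times the Wasserstein cost between the
empirical measure of the first `k` points and the law of the points. -/
lemma exists_lintegral_maxWassersteinPow_le (hd : 1 ≤ d) {p r v : ℝ} (hp : 1 ≤ p)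
    (hr₁ : 1 < r) (hr₂ : r < 2) (hv : IsRateExponent d p r v) : ∃ C : ℝ≥0, 0 < C ∧
      ∀ (n : ℕ) (μ : Measure (EuclideanSpace ℝ (Fin d))), IsProbabilityMeasure μ → 1 ≤ n →
      (∫⁻ x : Fin n → EuclideanSpace ℝ (Fin d), maxWassersteinPow p x μ ^ r
        ∂(Measure.pi fun _ => μ)) / (n : ℝ≥0∞) ^ r
      ≤ C * (supNormMoment (r * p) μ / (n : ℝ≥0∞) ^ (r * v)) := by
  obtain ⟨C, hC0, hC⟩ := exists_lintegral_maxWassersteinPow_le_radius hd hp hr₁ hr₂ hv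
  have hrp : 0 < r * p := by nlinarith
  refine ⟨C, hC0, fun n μ hμp hn => ?_⟩
  have hn0 : (n : ℝ≥0∞) ≠ 0 := by simpa using (by omega : n ≠ 0)
  have hN0 : (n : ℝ≥0∞) ^ (r * v) ≠ 0 := by simp [ENNReal.rpow_eq_zero_iff, hn0]
  have hNt : (n : ℝ≥0∞) ^ (r * v) ≠ ∞ := by simp [ENNReal.rpow_eq_top_iff, hn0]
  have hC0' : (C : ℝ≥0∞) ≠ 0 := by simpa using hC0.ne'
  have hcomm : ∀ z : ℝ≥0∞, (C : ℝ≥0∞) * (z / (n : ℝ≥0∞) ^ (r * v))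
      = (C : ℝ≥0∞) / (n : ℝ≥0∞) ^ (r * v) * z := fun z => by
    simp only [div_eq_mul_inv]; ring
  have hc0 : (C : ℝ≥0∞) / (n : ℝ≥0∞) ^ (r * v) ≠ 0 := ENNReal.div_ne_zero.2 ⟨hC0', hNt⟩
  have hct : (C : ℝ≥0∞) / (n : ℝ≥0∞) ^ (r * v) ≠ ∞ := ENNReal.div_ne_top ENNReal.coe_ne_top hN0
  rw [hcomm, ← ENNReal.div_le_iff' hc0 hct]
  -- Any `S` above the moment is positive, so `R = S ^ (1 / (r * p))` is an admissible scale; then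
  -- `S` decreases to the moment.
  refine le_of_forall_gt_imp_ge_of_dense fun S hS => ?_
  rcases eq_or_ne S ∞ with rfl | hSt
  · exact le_top
  lift S to ℝ≥0 using hSt
  have hS0 : 0 < S := by
    have := zero_le.trans_lt hS
    exact_mod_cast this
  have hRS : ((S ^ (r * p)⁻¹ : ℝ≥0) : ℝ≥0∞) ^ (r * p) = S := by
    rw [← ENNReal.coe_rpow_of_nonneg _ hrp.le, ← NNReal.rpow_mul, inv_mul_cancel₀ hrp.ne',
      NNReal.rpow_one]
  have h := hC (S ^ (r * p)⁻¹) n μ hμp (NNReal.rpow_pos hS0) hn (by rw [hRS]; exact hS.le)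
  rw [hRS, hcomm] at h
  rwa [ENNReal.div_le_iff' hc0 hct]

end MomentBound

/-! ### Transfer to an arbitrary probability space -/

section Transfer

variable {Ω : Type*} [MeasurableSpace Ω] {P : Measure Ω} [IsProbabilityMeasure P] {d n : ℕ}
  {μ : Measure (EuclideanSpace ℝ (Fin d))} {X : Fin n → Ω → EuclideanSpace ℝ (Fin d)}

omit [IsProbabilityMeasure P] in
lemma IsIIDSample.measurable_pi (hX : IsIIDSample P μ X) : Measurable fun ω i => X i ω :=
  measurable_pi_lambda _ hX.measurable

lemma IsIIDSample.isProbabilityMeasure (hX : IsIIDSample P μ X) (hn : 1 ≤ n) :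
    IsProbabilityMeasure μ := by
  rw [← hX.law ⟨0, hn⟩]
  exact Measure.isProbabilityMeasure_map (hX.measurable _).aemeasurable

lemma IsIIDSample.map_eq_pi (hX : IsIIDSample P μ X) :
    P.map (fun ω i => X i ω) = Measure.pi fun _ => μ := by
  rw [(iIndepFun_iff_map_fun_eq_pi_map fun i => (hX.measurable i).aemeasurable).1 hX.indep]
  simp_rw [hX.law]

lemma IsIIDSample.lintegral_eq (hX : IsIIDSample P μ X)
    {f : (Fin n → EuclideanSpace ℝ (Fin d)) → ℝ≥0∞} (hf : Measurable f) :
    ∫⁻ ω, f (fun i => X i ω) ∂P = ∫⁻ x, f x ∂(Measure.pi fun _ => μ) := by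
  rw [← hX.map_eq_pi, lintegral_map hf hX.measurable_pi]

lemma mul_wassersteinPow_le_max (hn : 1 ≤ n) (p : ℝ) (x : Fin n → EuclideanSpace ℝ (Fin d)) :
    n * wassersteinPow p (empiricalMeasure x) μ ≤ maxWassersteinPow p x μ := by
  obtain ⟨m, rfl⟩ : ∃ m, n = m + 1 := ⟨n - 1, by omega⟩
  exact le_iSup (fun j : Fin (m + 1) => ((j.val + 1 : ℕ) : ℝ≥0∞) *
    wassersteinPow p (empiricalMeasure fun i : Fin (j.val + 1) => x (Fin.castLE j.isLt i)) μ)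
    (Fin.last m)

lemma wassersteinPow_rpow_le (hn : 1 ≤ n) {p r : ℝ} (hr : 0 ≤ r)
    (x : Fin n → EuclideanSpace ℝ (Fin d)) :
    wassersteinPow p (empiricalMeasure x) μ ^ r
      ≤ maxWassersteinPow p x μ ^ r * ((n : ℝ≥0∞) ^ r)⁻¹ := by
  have hn0 : (n : ℝ≥0∞) ≠ 0 := by simpa using (by omega : n ≠ 0)
  rw [← div_eq_mul_inv, ← ENNReal.div_rpow_of_nonneg _ _ hr]
  refine ENNReal.rpow_le_rpow ?_ hr
  rw [ENNReal.le_div_iff_mul_le (Or.inl hn0) (Or.inl (by simp)), mul_comm]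
  exact mul_wassersteinPow_le_max hn p x

/-- The change of variables to the law of the sample is where measurability of the maximum is
needed; the other bound follows pointwise from the term `k = n`. -/
lemma IsIIDSample.moments_le (hX : IsIIDSample P μ X) (hn : 1 ≤ n) {p r : ℝ} (hp : 1 ≤ p)
    (hr : 1 < r) (hμ : supNormMoment (r * p) μ < ∞) {B : ℝ≥0∞}
    (hB : (∫⁻ x : Fin n → EuclideanSpace ℝ (Fin d), maxWassersteinPow p x μ ^ r
        ∂(Measure.pi fun _ => μ)) / (n : ℝ≥0∞) ^ r ≤ B) :
    ∫⁻ ω, wassersteinPow p (empiricalMeasure fun i => X i ω) μ ^ r ∂P ≤ B ∧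
      (∫⁻ ω, maxWassersteinPow p (fun i => X i ω) μ ^ r ∂P) / (n : ℝ≥0∞) ^ r ≤ B := by
  have := hX.isProbabilityMeasure hn
  have hn0 : (n : ℝ≥0∞) ≠ 0 := by simpa using (by omega : n ≠ 0)
  have hm := measurable_maxWassersteinPow (n := n) hp (lintegral_ofLp_rpow_lt_top hp hr hμ)
  rw [← hX.lintegral_eq (hm.pow_const r)] at hB
  refine ⟨le_trans ?_ hB, hB⟩
  rw [div_eq_mul_inv, ← lintegral_mul_const' _ _ (ENNReal.inv_ne_top.2
    (ENNReal.rpow_pos (pos_iff_ne_zero.2 hn0) (by simp)).ne')]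
  exact lintegral_mono fun ω => wassersteinPow_rpow_le hn (by linarith) _

end Transfer

theorem theorem5p3 (d : ℕ) (hd : 1 ≤ d) (p r : ℝ) (hp : 1 ≤ p) (hr₁ : 1 < r) (hr₂ : r < 2) :
    -- the two quantities whose moments are bounded are random variables
    (∀ {Ω : Type*} [MeasurableSpace Ω] (P : Measure Ω) [IsProbabilityMeasure P] (n : ℕ)
        (μ : Measure (EuclideanSpace ℝ (Fin d))) (X : Fin n → Ω → EuclideanSpace ℝ (Fin d)),
        1 ≤ n → IsIIDSample P μ X → supNormMoment (r * p) μ < ∞ →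
          Measurable (fun ω => wassersteinPow p (empiricalMeasure fun i => X i ω) μ) ∧
          Measurable (fun ω => maxWassersteinPow p (fun i => X i ω) μ)) ∧
    -- small dimension
    (d * (r - 1) / r < p → ∃ C : ℝ≥0, 0 < C ∧
      ∀ {Ω : Type*} [MeasurableSpace Ω] (P : Measure Ω) [IsProbabilityMeasure P] (n : ℕ)
        (μ : Measure (EuclideanSpace ℝ (Fin d))) (X : Fin n → Ω → EuclideanSpace ℝ (Fin d)),
        1 ≤ n → IsIIDSample P μ X → supNormMoment (r * p) μ < ∞ →
          ∫⁻ ω, wassersteinPow p (empiricalMeasure fun i => X i ω) μ ^ r ∂P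
            ≤ C * (supNormMoment (r * p) μ / (n : ℝ≥0∞) ^ (r - 1)) ∧
          (∫⁻ ω, maxWassersteinPow p (fun i => X i ω) μ ^ r ∂P) / (n : ℝ≥0∞) ^ r
            ≤ C * (supNormMoment (r * p) μ / (n : ℝ≥0∞) ^ (r - 1))) ∧
    -- large dimension
    (p < d * (r - 1) / r → ∃ C : ℝ≥0, 0 < C ∧
      ∀ {Ω : Type*} [MeasurableSpace Ω] (P : Measure Ω) [IsProbabilityMeasure P] (n : ℕ)
        (μ : Measure (EuclideanSpace ℝ (Fin d))) (X : Fin n → Ω → EuclideanSpace ℝ (Fin d)),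
        1 ≤ n → IsIIDSample P μ X → supNormMoment (r * p) μ < ∞ →
          ∫⁻ ω, wassersteinPow p (empiricalMeasure fun i => X i ω) μ ^ r ∂P
            ≤ C * (supNormMoment (r * p) μ / (n : ℝ≥0∞) ^ (r * p / d)) ∧
          (∫⁻ ω, maxWassersteinPow p (fun i => X i ω) μ ^ r ∂P) / (n : ℝ≥0∞) ^ r
            ≤ C * (supNormMoment (r * p) μ / (n : ℝ≥0∞) ^ (r * p / d))) := by
  have hd0 : (0 : ℝ) < d := by exact_mod_cast hd
  have hr0 : r ≠ 0 := by linarith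
  refine ⟨?_, fun h => ?_, fun h => ?_⟩
  · intro Ω _ P _ n μ X hn hX hμ
    have := hX.isProbabilityMeasure hn
    have hμp := lintegral_ofLp_rpow_lt_top hp hr₁ hμ
    have hW := (measurable_wassersteinPow_empiricalMeasure hp hn hμp).comp hX.measurable_pi
    have hmax := (measurable_maxWassersteinPow (n := n) hp hμp).comp hX.measurable_pi
    exact ⟨hW, hmax⟩
  · obtain ⟨C, hC0, hC⟩ := exists_lintegral_maxWassersteinPow_le hd hp hr₁ hr₂
      (Or.inl ⟨rfl, by rw [lt_div_iff₀ hd0]; linarith [h, show (r - 1) / r * d = d * (r - 1) / r by ring]⟩)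
    refine ⟨C, hC0, ?_⟩
    intro Ω _ P _ n μ X hn hX hμ
    refine hX.moments_le hn hp hr₁ hμ ?_
    have hb := hC n μ (hX.isProbabilityMeasure hn) hn
    rwa [show r * ((r - 1) / r) = r - 1 by field_simp] at hb
  · obtain ⟨C, hC0, hC⟩ := exists_lintegral_maxWassersteinPow_le hd hp hr₁ hr₂
      (Or.inr ⟨rfl, by rw [div_lt_iff₀ hd0]; linarith [h, show (r - 1) / r * d = d * (r - 1) / r by ring]⟩)
    refine ⟨C, hC0, ?_⟩
    intro Ω _ P _ n μ X hn hX hμ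
    refine hX.moments_le hn hp hr₁ hμ ?_
    have hb := hC n μ (hX.isProbabilityMeasure hn) hn
    rwa [show r * (p / d) = r * p / d by ring] at hb
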